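/- Let $n\ge 3$ and $s\ge 1$ be integers, let $\mu>0$, $\frac{2}{n}\mu+\mu'\ge 0$, $\kappa>0$, and put $\nu=\mu$, $\tilde\nu=\mu+\mu'$. Let $r_1>0$. Here $H^k$ is the usual $L^2$-Sobolev space on $\mathbb{R}^n$ with norm $\|u\|_{H^k}=\big(\sum_{|\alpha|\le k}\|\partial_x^\alpha u\|_{L^2}^2\big)^{1/2}$, $\hat u(\xi)=\int_{\mathbb{R}^n}u(x)e^{-ix\cdot\xi}\,dx$, and $H^k_{(\infty)}$ is the set of all $u\in H^k$ with $\operatorname{supp}\hat u\subset\{|\xi|\ge r_1\}$. The space $H^k_{(\infty)}\times H^j_{(\infty)}$ consists of the pairs $u={}^\top(\phi,m)$ of a function $\phi\in H^k_{(\infty)}$ and a vector field $m={}^\top(m_1,\dots,m_n)$ with components in $H^j_{(\infty)}$, and has the norm $\big(\|\phi\|_{H^k}^2+\sum_i\|m_i\|_{H^j}^2\big)^{1/2}$. Let $S(t)$, $t\ge 0$, be the solution operator of the linear system $$\partial_t\phi+\operatorname{div}m=0,\qquad \partial_t m-\nu\Delta m-\tilde\nu\nabla\operatorname{div}m-\kappa\nabla\Delta\phi=0,$$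 that is, $S(t)\,{}^\top(\phi_0,m_0)=\mathcal F^{-1}\Big\{\begin{pmatrix}S_{11}&S_{12}\\S_{21}&S_{22}\end{pmatrix}\begin{pmatrix}\hat\phi_0\\\hat m_0\end{pmatrix}\Big\}$ with $$S_{11}=\frac{\lambda_+e^{\lambda_-t}-\lambda_-e^{\lambda_+t}}{\lambda_+-\lambda_-},\qquad S_{12}=-i\,\frac{e^{\lambda_+t}-e^{\lambda_-t}}{\lambda_+-\lambda_-}\,{}^\top\xi,\qquad S_{21}=-i\xi\kappa|\xi|^2\,\frac{e^{\lambda_+t}-e^{\lambda_-t}}{\lambda_+-\lambda_-},$$ $$S_{22}=e^{-\nu|\xi|^2t}I_n+\Big(\frac{\lambda_+e^{\lambda_+t}-\lambda_-e^{\lambda_-t}}{\lambda_+-\lambda_-}-e^{-\nu|\xi|^2t}\Big)\frac{\xi\,{}^\top\xi}{|\xi|^2},$$ where $\lambda_\pm(\xi)=-A\big(|\xi|^2\pm|\xi|^2\sqrt{1-K^2}\big)$, $A=\frac{\nu+\tilde\nu}{2}$, $K=\frac{2\sqrt\kappa}{\nu+\tilde\nu}$ (complex square root), and where the quotients are replaced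 by their limits if $\lambda_+=\lambda_-$. For a forcing $F_\infty$ with values in high-frequency pairs, put $$\mathscr S_\infty(t)F_\infty=\int_0^tS(t-\tau)F_\infty(\tau)\,d\tau .$$ Then there is a constant $C$, depending only on $n,s,\mu,\mu',\kappa,r_1$, such that for every $T>0$ and every $F_\infty\in L^2(0,T;H^s_{(\infty)}\times H^{s-1}_{(\infty)})$ the integral defining $\mathscr S_\infty(t)F_\infty$ converges (as a Bochner integral in $L^2$) for every $t\in[0,T]$, $$\mathscr S_\infty(\cdot)F_\infty\in C([0,T];H^{s+1}_{(\infty)}\times H^s_{(\infty)})\cap L^2(0,T;H^{s+2}_{(\infty)}\times H^{s+1}_{(\infty)}),$$ and for all $t\in[0,T]$ $$\|\mathscr S_\infty(t)F_\infty\|_{H^{s+1}_{(\infty)}\times H^s_{(\infty)}}+\|\mathscr S_\infty(\cdot)F_\infty\|_{L^2(0,T;H^{s+2}_{(\infty)}\times H^{s+1}_{(\infty)})}\le C\,\|F_\infty\|_{L^2(0,T;H^s_{(\infty)}\times H^{s-1}_{(\infty)})}.$$ -/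

import Mathlib

open MeasureTheory FourierTransform LineDeriv
open scoped NNReal ENNReal SchwartzMap

noncomputable section

namespace NSK

/-- The physical (and frequency) space `ℝⁿ` with its Euclidean norm. -/
abbrev Space (n : ℕ) : Type := EuclideanSpace ℝ (Fin n)

/-- `L²(ℝⁿ)`, complex valued. -/
abbrev L2 (n : ℕ) : Type := Lp ℂ 2 (volume : Measure (Space n))

/-! ### Sobolev spaces -/

/-- The finite set of multi-indices `α ∈ ℕⁿ` with `|α| ≤ k`. -/
def multiIndices (n k : ℕ) : Finset (Fin n → ℕ) :=
  (Fintype.piFinset fun _ : Fin n => Finset.range (k + 1)).filter fun α => ∑ j, α j ≤ k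

theorem mem_multiIndices {n k : ℕ} {α : Fin n → ℕ} :
    α ∈ multiIndices n k ↔ ∑ j, α j ≤ k := by
  simp only [multiIndices, Finset.mem_filter, Fintype.mem_piFinset, Finset.mem_range,
    and_iff_right_iff_imp]
  intro h j
  have := Finset.single_le_sum (f := α) (fun i _ => Nat.zero_le _) (Finset.mem_univ j)
  omega

/-- The multi-index `0`. -/
def zeroIndex (n k : ℕ) : multiIndices n k := ⟨0, by simp [mem_multiIndices]⟩

/-- Families `(u_α)_{|α| ≤ k}` of `L²` functions, with the norm `(∑_α ‖u_α‖²)^{1/2}`. -/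
abbrev Jet (n k : ℕ) : Type := PiLp 2 fun _ : multiIndices n k => L2 n

/-- The `j`-th standard basis vector of `ℝⁿ`. -/
def basisVec {n : ℕ} (j : Fin n) : Space n := EuclideanSpace.single j (1 : ℝ)

/-- The usual Sobolev space `H^k(ℝⁿ)`. A function `u ∈ H^k` is represented by the family
`(∂^α u)_{|α| ≤ k}` of its weak derivatives, all of which have to be `L²` functions: the member with
index `α + e_j` is the distributional derivative `∂_j` of the member with index `α`. So the norm
inherited from `Jet` is the usual norm `‖u‖_{H^k} = (∑_{|α| ≤ k} ‖∂^α u‖_{L²}²)^{1/2}`. -/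
def sobolev (n k : ℕ) : Submodule ℂ (Jet n k) where
  carrier := {u | ∀ (α β : multiIndices n k) (j : Fin n), β.1 = α.1 + Pi.single j 1 →
    (u β : 𝓢'(Space n, ℂ)) = ∂_{basisVec j} (u α : 𝓢'(Space n, ℂ))}
  add_mem' := by
    intro u v hu hv α β j h
    have h1 := hu α β j h
    have h2 := hv α β j h
    simp only [← Lp.toTemperedDistributionCLM_apply, PiLp.add_apply, map_add, lineDerivOp_add] at *
    rw [h1, h2]
  zero_mem' := by
    intro α β j h
    simp only [← Lp.toTemperedDistributionCLM_apply, PiLp.zero_apply, map_zero, lineDerivOp_zero]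
  smul_mem' := by
    intro c u hu α β j h
    have h1 := hu α β j h
    simp only [← Lp.toTemperedDistributionCLM_apply, PiLp.smul_apply, map_smul,
      lineDerivOp_smul] at *
    rw [h1]

/-- `supp û ⊆ {|ξ| ≥ r}` for an `L²` function `u`, where `û(ξ) = ∫ u(x) e^{-i x·ξ} dx`. Mathlib's
transform is `𝓕 u (η) = ∫ u(x) e^{-2πi x·η} dx`, so `û(ξ) = 𝓕 u (η)` with `ξ = 2π η`. -/
def IsHighFreq {n : ℕ} (r : ℝ) (u : L2 n) : Prop :=
  ∀ᵐ η : Space n, ‖(2 * Real.pi) • η‖ < r → (𝓕 u : L2 n) η = 0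

/-- The space `H^k_{(∞)}` of all `u ∈ H^k` with `supp û ⊆ {|ξ| ≥ r}`, with the norm of `H^k`. -/
def highSobolev (n : ℕ) (r : ℝ) (k : ℕ) : Submodule ℂ (Jet n k) where
  carrier := {u | u ∈ sobolev n k ∧ IsHighFreq r (u (zeroIndex n k))}
  add_mem' := by
    rintro u v ⟨hu, hu'⟩ ⟨hv, hv'⟩
    refine ⟨add_mem hu hv, ?_⟩
    simp only [IsHighFreq, PiLp.add_apply] at *
    have h0 : (𝓕 (u (zeroIndex n k) + v (zeroIndex n k)) : L2 n) =
        𝓕 (u (zeroIndex n k)) + 𝓕 (v (zeroIndex n k)) :=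
      (Lp.fourierTransformₗᵢ (Space n) ℂ).map_add _ _
    rw [h0]
    filter_upwards [hu', hv', Lp.coeFn_add (𝓕 (u (zeroIndex n k))) (𝓕 (v (zeroIndex n k)))]
      with η h1 h2 h3 h
    rw [h3, Pi.add_apply, h1 h, h2 h, add_zero]
  zero_mem' := by
    refine ⟨zero_mem _, ?_⟩
    simp only [IsHighFreq, PiLp.zero_apply]
    have h0 : (𝓕 (0 : L2 n) : L2 n) = 0 := (Lp.fourierTransformₗᵢ (Space n) ℂ).map_zero
    rw [h0]
    filter_upwards [Lp.coeFn_zero ℂ 2 (volume : Measure (Space n))] with η h1 _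
    rw [h1, Pi.zero_apply]
  smul_mem' := by
    rintro c u ⟨hu, hu'⟩
    refine ⟨Submodule.smul_mem _ _ hu, ?_⟩
    simp only [IsHighFreq, PiLp.smul_apply, fourier_smul] at *
    filter_upwards [hu', Lp.coeFn_smul c (𝓕 (u (zeroIndex n k)))] with η h1 h3 h
    rw [h3, Pi.smul_apply, h1 h, smul_zero]

/-- The space `H^k_{(∞)} × H^j_{(∞)}` of pairs `(φ, m)`, `m` being a vector field with `n`
components, with the norm `(‖φ‖_{H^k}² + ∑_i ‖m_i‖_{H^j}²)^{1/2}`. -/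
abbrev HighPair (n : ℕ) (r : ℝ) (k j : ℕ) : Type :=
  WithLp 2 (highSobolev n r k × PiLp 2 fun _ : Fin n => highSobolev n r j)

/-- The space `L² × (L²)ⁿ` of pairs `(φ, m)`, with its `ℓ²` product norm. -/
abbrev L2Pair (n : ℕ) : Type := WithLp 2 (L2 n × PiLp 2 fun _ : Fin n => L2 n)

/-- The inclusion of `H^k_{(∞)} × H^j_{(∞)}` into `L² × (L²)ⁿ`. -/
def HighPair.toL2 {n : ℕ} {r : ℝ} {k j : ℕ} (u : HighPair n r k j) : L2Pair n :=
  WithLp.toLp 2 (u.fst.1 (zeroIndex n k), WithLp.toLp 2 fun i => (u.snd i).1 (zeroIndex n j))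

/-! ### The solution operator of the linearized system -/

/-- The root `λ₊ = -A (x + x √(1 - K²))`, where `x = |ξ|²`, `A = (ν + ν')/2` and
`K = 2 √κ / (ν + ν')`; the square root is complex. Here and below `ν'` stands for `ν̃`. -/
def lamPlus (ν ν' κ x : ℝ) : ℂ :=
  -((ν + ν') / 2 : ℝ) * (x + x * ((1 - (2 * √κ / (ν + ν')) ^ 2 : ℝ) : ℂ) ^ (1 / 2 : ℂ))

/-- The root `λ₋ = -A (x - x √(1 - K²))`. -/
def lamMinus (ν ν' κ x : ℝ) : ℂ :=
  -((ν + ν') / 2 : ℝ) * (x - x * ((1 - (2 * √κ / (ν + ν')) ^ 2 : ℝ) : ℂ) ^ (1 / 2 : ℂ))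

/-- `(a e^{bt} - b e^{at}) / (a - b)`, continued to `a = b` by its limit. -/
def kernelZero (a b : ℂ) (t : ℝ) : ℂ :=
  if a = b then (1 - a * t) * Complex.exp (a * t)
  else (a * Complex.exp (b * t) - b * Complex.exp (a * t)) / (a - b)

/-- `(e^{at} - e^{bt}) / (a - b)`, continued to `a = b` by its limit. -/
def kernelOne (a b : ℂ) (t : ℝ) : ℂ :=
  if a = b then t * Complex.exp (a * t)
  else (Complex.exp (a * t) - Complex.exp (b * t)) / (a - b)

/-- `(a e^{at} - b e^{bt}) / (a - b)`, continued to `a = b` by its limit. -/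
def kernelTwo (a b : ℂ) (t : ℝ) : ℂ :=
  if a = b then (1 + a * t) * Complex.exp (a * t)
  else (a * Complex.exp (a * t) - b * Complex.exp (b * t)) / (a - b)

theorem kernelZero_eq (a b : ℂ) (t : ℝ) :
    kernelZero a b t = Complex.exp (b * t) - b * kernelOne a b t := by
  unfold kernelZero kernelOne
  split_ifs with h
  · subst h; ring
  · have : a - b ≠ 0 := sub_ne_zero.2 h
    field_simp; ring

theorem kernelTwo_eq (a b : ℂ) (t : ℝ) :
    kernelTwo a b t = Complex.exp (a * t) + b * kernelOne a b t := by
  unfold kernelTwo kernelOne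
  split_ifs with h
  · subst h; ring
  · have : a - b ≠ 0 := sub_ne_zero.2 h
    field_simp; ring

theorem norm_kernelOne_le {a b : ℂ} {t d : ℝ} (ht : 0 ≤ t) (ha : a.re ≤ -d) (hb : b.re ≤ -d) :
    ‖kernelOne a b t‖ ≤ t * Real.exp (-d * t) := by
  have key : ∀ z : ℂ, z.re ≤ -d → ‖Complex.exp (z * t)‖ ≤ Real.exp (-d * t) := by
    intro z hz
    rw [Complex.norm_exp, Complex.re_mul_ofReal]
    exact Real.exp_le_exp.2 (mul_le_mul_of_nonneg_right hz ht)
  unfold kernelOne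
  split_ifs with h
  · rw [norm_mul, Complex.norm_real, Real.norm_of_nonneg ht]
    exact mul_le_mul_of_nonneg_left (key a ha) ht
  · have h1 : 0 < ‖a - b‖ := norm_pos_iff.2 (sub_ne_zero.2 h)
    rw [norm_div, div_le_iff₀ h1]
    refine (convex_halfSpace_re_le (-d)).norm_image_sub_le_of_norm_hasDerivWithin_le
      (f := fun z : ℂ => Complex.exp (z * t)) (f' := fun z : ℂ => Complex.exp (z * t) * t)
      (fun z _ => ?_) (fun z hz => ?_) hb ha
    · simpa using ((hasDerivAt_mul_const (t : ℂ)).cexp (x := z)).hasDerivWithinAt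
    · rw [norm_mul, Complex.norm_real, Real.norm_of_nonneg ht, mul_comm]
      exact mul_le_mul_of_nonneg_left (key z hz) ht

/-- The roots have real part at most `-c x` and modulus at most `M x`. -/
theorem exists_lam_bounds {ν ν' κ : ℝ} (hν : 0 < ν + ν') (hκ : 0 < κ) :
    ∃ c M : ℝ, 0 < c ∧ 0 ≤ M ∧ ∀ x : ℝ, 0 ≤ x →
      (lamPlus ν ν' κ x).re ≤ -(c * x) ∧ (lamMinus ν ν' κ x).re ≤ -(c * x) ∧
      ‖lamMinus ν ν' κ x‖ ≤ M * x := by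
  set w : ℂ := ((1 - (2 * √κ / (ν + ν')) ^ 2 : ℝ) : ℂ) ^ (1 / 2 : ℂ) with hw
  have hKpos : 0 < (2 * √κ / (ν + ν')) ^ 2 := by positivity
  have hsq : w ^ 2 = ((1 - (2 * √κ / (ν + ν')) ^ 2 : ℝ) : ℂ) := by
    rw [hw, ← Complex.cpow_nat_mul]; norm_num
  have hre : |w.re| < 1 := by
    have h1 := congrArg Complex.re hsq
    have h2 := congrArg Complex.im hsq
    simp only [pow_two w, Complex.mul_re, Complex.mul_im, Complex.ofReal_re,
      Complex.ofReal_im] at h1 h2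
    have h3 : w.re * w.im = 0 := by linarith
    rcases mul_eq_zero.1 h3 with h | h
    · simp [h]
    · rw [h] at h1
      rw [← sq_lt_one_iff_abs_lt_one]
      nlinarith
  have hA : 0 < (ν + ν') / 2 := by positivity
  obtain ⟨h1, h2⟩ := abs_lt.1 hre
  refine ⟨(ν + ν') / 2 * (1 - |w.re|), (ν + ν') / 2 * (1 + ‖w‖),
    mul_pos hA (by linarith), by positivity, fun x hx => ⟨?_, ?_, ?_⟩⟩
  · have : (lamPlus ν ν' κ x).re = -((ν + ν') / 2 * x * (1 + w.re)) := by
      rw [lamPlus, ← hw, ← Complex.ofReal_neg, Complex.re_ofReal_mul, Complex.add_re,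
        Complex.re_ofReal_mul, Complex.ofReal_re]
      ring
    rw [this]
    have := mul_le_mul_of_nonneg_left (neg_abs_le w.re) (mul_nonneg hA.le hx)
    linarith
  · have : (lamMinus ν ν' κ x).re = -((ν + ν') / 2 * x * (1 - w.re)) := by
      rw [lamMinus, ← hw, ← Complex.ofReal_neg, Complex.re_ofReal_mul, Complex.sub_re,
        Complex.re_ofReal_mul, Complex.ofReal_re]
      ring
    rw [this]
    have := mul_le_mul_of_nonneg_left (le_abs_self w.re) (mul_nonneg hA.le hx)
    linarith
  · rw [lamMinus, ← hw, ← Complex.ofReal_neg, norm_mul, Complex.norm_real, norm_neg,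
      Real.norm_of_nonneg hA.le, mul_assoc]
    refine mul_le_mul_of_nonneg_left ?_ hA.le
    have h3 := norm_sub_le (x : ℂ) (x * w)
    rw [norm_mul, Complex.norm_real, Real.norm_of_nonneg hx] at h3
    linarith

theorem measurable_kernelOne {n : ℕ} (ν ν' κ t : ℝ) : Measurable fun ξ : Space n =>
    kernelOne (lamPlus ν ν' κ (‖ξ‖ ^ 2)) (lamMinus ν ν' κ (‖ξ‖ ^ 2)) t := by
  have h1 : Measurable fun ξ : Space n => lamPlus ν ν' κ (‖ξ‖ ^ 2) := by
    unfold lamPlus; fun_prop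
  have h2 : Measurable fun ξ : Space n => lamMinus ν ν' κ (‖ξ‖ ^ 2) := by
    unfold lamMinus; fun_prop
  unfold kernelOne
  exact Measurable.ite (measurableSet_eq_fun h1 h2) (by fun_prop) (by fun_prop)

/-- Powers of `|ξ|` are dominated by the decay of the kernel at any fixed time. -/
theorem exists_mul_kernelOne_le {n : ℕ} {ν ν' κ t : ℝ} (hν : 0 < ν + ν') (hκ : 0 < κ)
    (ht : 0 ≤ t) : ∃ C : ℝ, ∀ ξ : Space n, (1 + ‖ξ‖ ^ 2) ^ 2 *
      ‖kernelOne (lamPlus ν ν' κ (‖ξ‖ ^ 2)) (lamMinus ν ν' κ (‖ξ‖ ^ 2)) t‖ ≤ C := by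
  obtain ⟨c, M, hc, -, hb⟩ := exists_lam_bounds hν hκ
  rcases ht.eq_or_lt with rfl | ht
  · exact ⟨0, fun ξ => by simp [kernelOne]⟩
  refine ⟨t * (2 / (c * t) ^ 2 * Real.exp (c * t)), fun ξ => ?_⟩
  obtain ⟨h1, h2, -⟩ := hb (‖ξ‖ ^ 2) (by positivity)
  have h3 := norm_kernelOne_le ht.le h1 h2
  set y := 1 + ‖ξ‖ ^ 2 with hy
  have hy1 : 0 ≤ y := by positivity
  have hct : 0 < c * t := mul_pos hc ht
  have h4 : Real.exp (-(c * ‖ξ‖ ^ 2) * t) = Real.exp (-(c * t * y)) * Real.exp (c * t) := by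
    rw [← Real.exp_add]; congr 1; rw [hy]; ring
  have h5 : y ^ 2 * Real.exp (-(c * t * y)) ≤ 2 / (c * t) ^ 2 := by
    rw [Real.exp_neg, ← div_eq_mul_inv, div_le_div_iff₀ (Real.exp_pos _) (by positivity)]
    have := Real.quadratic_le_exp_of_nonneg (mul_nonneg hct.le hy1)
    nlinarith [mul_nonneg hct.le hy1]
  calc _ ≤ y ^ 2 * (t * (Real.exp (-(c * t * y)) * Real.exp (c * t))) := by
        rw [← h4]; exact mul_le_mul_of_nonneg_left h3 (by positivity)
    _ = t * (y ^ 2 * Real.exp (-(c * t * y)) * Real.exp (c * t)) := by ring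
    _ ≤ _ := by gcongr

theorem abs_coord_le {n : ℕ} (ξ : Space n) (i : Fin n) : |ξ i| ≤ ‖ξ‖ := by
  simpa using PiLp.norm_apply_le ξ i

/-- A bounded measurable multiple of a Fourier transform is an `L²` function. -/
theorem memLp_mul_fourier {n : ℕ} {p : Space n → ℂ} (hp : Measurable p)
    (hb : ∃ C : ℝ, ∀ ξ, ‖p ξ‖ ≤ C) (f : L2 n) :
    MemLp (fun η => p ((2 * Real.pi) • η) * (𝓕 f : L2 n) η) 2 volume := by
  obtain ⟨C, hC⟩ := hb
  refine MemLp.of_le_mul (g := fun η => (𝓕 f : L2 n) η) (c := C) (Lp.memLp _) ?_ ?_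
  · exact ((hp.comp (measurable_const_smul (2 * Real.pi))).aestronglyMeasurable).mul
      (Lp.aestronglyMeasurable _)
  · filter_upwards with η
    rw [norm_mul]
    exact mul_le_mul_of_nonneg_right (hC _) (norm_nonneg _)

section Symbols

variable (n : ℕ) (ν ν' κ t : ℝ)

/-- The entry `S₁₁` of the symbol. -/
def symbol11 (ξ : Space n) : ℂ :=
  kernelZero (lamPlus ν ν' κ (‖ξ‖ ^ 2)) (lamMinus ν ν' κ (‖ξ‖ ^ 2)) t

/-- The entries of the row `S₁₂` of the symbol. -/
def symbol12 (ξ : Space n) (j : Fin n) : ℂ :=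
  -Complex.I * kernelOne (lamPlus ν ν' κ (‖ξ‖ ^ 2)) (lamMinus ν ν' κ (‖ξ‖ ^ 2)) t * (ξ j : ℂ)

/-- The entries of the column `S₂₁` of the symbol. -/
def symbol21 (ξ : Space n) (i : Fin n) : ℂ :=
  -Complex.I * (ξ i : ℂ) * (κ : ℂ) * ((‖ξ‖ ^ 2 : ℝ) : ℂ) *
    kernelOne (lamPlus ν ν' κ (‖ξ‖ ^ 2)) (lamMinus ν ν' κ (‖ξ‖ ^ 2)) t

/-- The entries of the block `S₂₂` of the symbol. -/
def symbol22 (ξ : Space n) (i j : Fin n) : ℂ :=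
  Complex.exp ((-ν * ‖ξ‖ ^ 2 * t : ℝ) : ℂ) * (if i = j then 1 else 0) +
    (kernelTwo (lamPlus ν ν' κ (‖ξ‖ ^ 2)) (lamMinus ν ν' κ (‖ξ‖ ^ 2)) t -
      Complex.exp ((-ν * ‖ξ‖ ^ 2 * t : ℝ) : ℂ)) * ((ξ i * ξ j / ‖ξ‖ ^ 2 : ℝ) : ℂ)

variable {n}

/-- The Fourier transform of the density of `S(t) u`, as a function of `η = ξ / 2π`. -/
def densityHat (u : L2Pair n) (η : Space n) : ℂ :=
  symbol11 n ν ν' κ t ((2 * Real.pi) • η) * (𝓕 u.fst : L2 n) η +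
    ∑ j, symbol12 n ν ν' κ t ((2 * Real.pi) • η) j * (𝓕 (u.snd j) : L2 n) η

/-- The Fourier transform of the `i`-th component of the momentum of `S(t) u`, as a function of
`η = ξ / 2π`. -/
def momentumHat (u : L2Pair n) (i : Fin n) (η : Space n) : ℂ :=
  symbol21 n ν ν' κ t ((2 * Real.pi) • η) i * (𝓕 u.fst : L2 n) η +
    ∑ j, symbol22 n ν ν' κ t ((2 * Real.pi) • η) i j * (𝓕 (u.snd j) : L2 n) η

end Symbols

section WellDefined

variable {n : ℕ} {ν ν' κ t : ℝ}

theorem symbol11_bounded (hν : 0 < ν + ν') (hκ : 0 < κ) (ht : 0 ≤ t) :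
    ∃ C : ℝ, ∀ ξ, ‖symbol11 n ν ν' κ t ξ‖ ≤ C := by
  obtain ⟨c, M, hc, hM, hb⟩ := exists_lam_bounds hν hκ
  obtain ⟨C, hC⟩ := exists_mul_kernelOne_le (n := n) hν hκ ht
  refine ⟨1 + M * C, fun ξ => ?_⟩
  obtain ⟨h1, h2, h3⟩ := hb (‖ξ‖ ^ 2) (by positivity)
  have h4 := hC ξ
  rw [symbol11, kernelZero_eq]
  refine (norm_sub_le _ _).trans (add_le_add ?_ ?_)
  · rw [Complex.norm_exp, Complex.re_mul_ofReal, Real.exp_le_one_iff]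
    exact mul_nonpos_of_nonpos_of_nonneg (h2.trans (by simp; positivity)) ht
  · rw [norm_mul]
    refine (mul_le_mul_of_nonneg_right h3 (norm_nonneg _)).trans ?_
    rw [mul_assoc]
    refine mul_le_mul_of_nonneg_left (le_trans ?_ h4) hM
    exact mul_le_mul_of_nonneg_right (by nlinarith [sq_nonneg ‖ξ‖]) (norm_nonneg _)

theorem symbol12_bounded (hν : 0 < ν + ν') (hκ : 0 < κ) (ht : 0 ≤ t) (j : Fin n) :
    ∃ C : ℝ, ∀ ξ, ‖symbol12 n ν ν' κ t ξ j‖ ≤ C := by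
  obtain ⟨C, hC⟩ := exists_mul_kernelOne_le (n := n) hν hκ ht
  refine ⟨C, fun ξ => le_trans ?_ (hC ξ)⟩
  rw [symbol12, norm_mul, norm_mul, norm_neg, Complex.norm_I, one_mul, Complex.norm_real, mul_comm]
  refine mul_le_mul_of_nonneg_right ((abs_coord_le ξ j).trans ?_) (norm_nonneg _)
  nlinarith [sq_nonneg (‖ξ‖ - 1), sq_nonneg (‖ξ‖ ^ 2)]

theorem symbol21_bounded (hν : 0 < ν + ν') (hκ : 0 < κ) (ht : 0 ≤ t) (i : Fin n) :
    ∃ C : ℝ, ∀ ξ, ‖symbol21 n ν ν' κ t ξ i‖ ≤ C := by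
  obtain ⟨C, hC⟩ := exists_mul_kernelOne_le (n := n) hν hκ ht
  refine ⟨κ * C, fun ξ => le_trans ?_ (mul_le_mul_of_nonneg_left (hC ξ) hκ.le)⟩
  rw [symbol21, norm_mul, norm_mul, norm_mul, norm_mul, norm_neg, Complex.norm_I, one_mul,
    Complex.norm_real, Complex.norm_real, Complex.norm_real, Real.norm_of_nonneg hκ.le,
    Real.norm_of_nonneg (sq_nonneg ‖ξ‖), ← mul_assoc, mul_comm ‖ξ i‖ κ, mul_assoc κ]
  refine mul_le_mul_of_nonneg_right (mul_le_mul_of_nonneg_left ?_ hκ.le) (norm_nonneg _)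
  refine (mul_le_mul_of_nonneg_right (abs_coord_le ξ i) (sq_nonneg _)).trans ?_
  nlinarith [sq_nonneg (‖ξ‖ - 1), sq_nonneg (‖ξ‖ ^ 2), sq_nonneg (‖ξ‖ ^ 2 - ‖ξ‖), norm_nonneg ξ]

theorem symbol22_bounded (hν₀ : 0 ≤ ν) (hν : 0 < ν + ν') (hκ : 0 < κ) (ht : 0 ≤ t)
    (i j : Fin n) : ∃ C : ℝ, ∀ ξ, ‖symbol22 n ν ν' κ t ξ i j‖ ≤ C := by
  obtain ⟨c, M, hc, hM, hb⟩ := exists_lam_bounds hν hκ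
  obtain ⟨C, hC⟩ := exists_mul_kernelOne_le (n := n) hν hκ ht
  refine ⟨1 * 1 + (1 + M * C + 1) * 1, fun ξ => ?_⟩
  obtain ⟨h1, h2, h3⟩ := hb (‖ξ‖ ^ 2) (by positivity)
  have h4 := hC ξ
  have h5 : ‖Complex.exp ((-ν * ‖ξ‖ ^ 2 * t : ℝ) : ℂ)‖ ≤ 1 := by
    rw [Complex.norm_exp, Complex.ofReal_re, Real.exp_le_one_iff]
    have : 0 ≤ ν * ‖ξ‖ ^ 2 * t := by positivity
    linarith
  have h6 : ‖kernelTwo (lamPlus ν ν' κ (‖ξ‖ ^ 2)) (lamMinus ν ν' κ (‖ξ‖ ^ 2)) t‖ ≤ 1 + M * C := by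
    rw [kernelTwo_eq]
    refine (norm_add_le _ _).trans (add_le_add ?_ ?_)
    · rw [Complex.norm_exp, Complex.re_mul_ofReal, Real.exp_le_one_iff]
      exact mul_nonpos_of_nonpos_of_nonneg (h1.trans (by simp; positivity)) ht
    · rw [norm_mul]
      refine (mul_le_mul_of_nonneg_right h3 (norm_nonneg _)).trans ?_
      rw [mul_assoc]
      refine mul_le_mul_of_nonneg_left (le_trans ?_ h4) hM
      exact mul_le_mul_of_nonneg_right (by nlinarith [sq_nonneg ‖ξ‖]) (norm_nonneg _)
  have h7 : ‖((ξ i * ξ j / ‖ξ‖ ^ 2 : ℝ) : ℂ)‖ ≤ 1 := by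
    rw [Complex.norm_real, Real.norm_eq_abs, abs_div, abs_mul, abs_of_nonneg (sq_nonneg ‖ξ‖), sq]
    exact div_le_one_of_le₀ (mul_le_mul (abs_coord_le ξ i) (abs_coord_le ξ j) (abs_nonneg _)
      (norm_nonneg _)) (by positivity)
  rw [symbol22]
  refine (norm_add_le _ _).trans (add_le_add ?_ ?_)
  · rw [norm_mul]
    refine mul_le_mul h5 ?_ (norm_nonneg _) zero_le_one
    split_ifs <;> simp
  · rw [norm_mul]
    exact mul_le_mul ((norm_sub_le _ _).trans (add_le_add h6 h5)) h7 (norm_nonneg _)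
      (by have := (norm_nonneg _).trans h6; linarith)

theorem memLp_densityHat (hν : 0 < ν + ν') (hκ : 0 < κ) (ht : 0 ≤ t) (u : L2Pair n) :
    MemLp (densityHat ν ν' κ t u) 2 volume := by
  have hm := measurable_kernelOne (n := n) ν ν' κ t
  refine (memLp_mul_fourier ?_ (symbol11_bounded hν hκ ht) u.fst).add
    (memLp_finsetSum _ fun j _ => memLp_mul_fourier ?_ (symbol12_bounded hν hκ ht j) (u.snd j))
  · unfold symbol11
    simp only [kernelZero_eq]
    have h2 : Measurable fun ξ : Space n => lamMinus ν ν' κ (‖ξ‖ ^ 2) := by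
      unfold lamMinus; fun_prop
    fun_prop
  · unfold symbol12
    fun_prop

theorem memLp_momentumHat (hν₀ : 0 ≤ ν) (hν : 0 < ν + ν') (hκ : 0 < κ) (ht : 0 ≤ t)
    (u : L2Pair n) (i : Fin n) : MemLp (momentumHat ν ν' κ t u i) 2 volume := by
  have hm := measurable_kernelOne (n := n) ν ν' κ t
  refine (memLp_mul_fourier ?_ (symbol21_bounded hν hκ ht i) u.fst).add
    (memLp_finsetSum _ fun j _ =>
      memLp_mul_fourier ?_ (symbol22_bounded hν₀ hν hκ ht i j) (u.snd j))
  · unfold symbol21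
    fun_prop
  · unfold symbol22
    simp only [kernelTwo_eq]
    have h1 : Measurable fun ξ : Space n => lamPlus ν ν' κ (‖ξ‖ ^ 2) := by
      unfold lamPlus; fun_prop
    have h2 : Measurable fun ξ : Space n => lamMinus ν ν' κ (‖ξ‖ ^ 2) := by
      unfold lamMinus; fun_prop
    fun_prop

end WellDefined

open Classical in
/-- The `L²` function with a given Fourier transform `g ∈ L²` (and `0` if `g ∉ L²`). -/
def ofFourier {n : ℕ} (g : Space n → ℂ) : L2 n :=
  if h : MemLp g 2 volume then (𝓕⁻ (h.toLp g) : L2 n) else 0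

/-- The solution operator `S(t)` of `∂ₜφ + div m = 0`,
`∂ₜm - ν Δm - ν' ∇ div m - κ ∇Δφ = 0` on `L² × (L²)ⁿ`, given by its symbol.
For `t ≥ 0` the two functions fed to `ofFourier` are in `L²`, see `memLp_densityHat` and
`memLp_momentumHat`. -/
def solOp {n : ℕ} (ν ν' κ t : ℝ) (u : L2Pair n) : L2Pair n :=
  WithLp.toLp 2 (ofFourier (densityHat ν ν' κ t u),
    WithLp.toLp 2 fun i => ofFourier (momentumHat ν ν' κ t u i))

/-- The Duhamel term `∫₀ᵗ S(t - τ) F(τ) dτ`, a Bochner integral in `L² × (L²)ⁿ`, of a forcing `F`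
with values in a space of high frequency pairs. -/
def duhamel {n : ℕ} {r : ℝ} {k j : ℕ} (ν ν' κ : ℝ) (F : ℝ → HighPair n r k j) (t : ℝ) : L2Pair n :=
  ∫ τ in (0 : ℝ)..t, solOp ν ν' κ (t - τ) (F τ).toL2

end NSK

end

/-! In the variables $(|\xi|\hat\phi,\hat m)$ the symbol of $S(t)$ is parabolic: each entry is
bounded by $Ce^{-c|\xi|^2t}$. Both roots have real part at most $-c_0|\xi|^2$. The divided
difference of exponentials is at most $te^{-c_0|\xi|^2t}$, also at a double root, and half of the
exponential absorbs the factor $|\xi|^2t$ (`exists_isDecaying_entry`). The problem thus reduces to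
scalar time convolutions $\int_0^tp(t-\tau)f(\tau)\,d\tau$ in $L^2$ with $|p(t)|\le Ce^{-cw^2t}$,
$w=|\xi|$. They have to gain $w$ uniformly in time and $w^2$ in $L^2$ in time.

Both gains rest on the square function bound $\int_0^\infty\|we^{-cw^2\sigma/2}g\|^2d\sigma\le
c^{-1}\|g\|^2$, which is Tonelli and a scalar integral. The weighted convolution $v$ is paired with
itself. For one power of $w$, the factor $we^{-cw^2(t-\tau)/2}$ is moved onto $v$ and Cauchy–Schwarz
in $\tau$ is applied (`enorm_integral_sq_le`). For two powers, one such factor goes to $v$ and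
another to $f(\tau)$; a second use of the square function bound, now in $t$, closes the estimate.

Since $w$ is unbounded, this is first done for $w$ truncated to $\{w\le N\}$, with constants
independent of $N$. Fatou's lemma removes the truncation, and continuity in time survives because
the truncated convolutions converge uniformly in $t$ (`exists_continuousOn`, `exists_memLp`).

On $|\xi|\ge r_1$ the norm of $H^k$ is equivalent to $\||\xi|^k\hat u\|_{L^2}$: pure $k$-th
derivatives control $|\xi|^k\hat u$, and lower derivatives cost powers of $r_1^{-1}$. Hence powers
of $|\xi|$ are the same as derivatives (`lowerHigh`, `liftHigh`, `lowLift_add`), and summing over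
the matrix entries gives the theorem. -/

noncomputable section

namespace NSK

/-! ### Multiplication operators on $L^2$. -/

section Multiplication

open Filter Topology

variable {X : Type*} [MeasurableSpace X] {μ : Measure X}

/-- Bounded measurable functions. -/
def IsBddMeas (p : X → ℂ) : Prop := Measurable p ∧ ∃ C : ℝ, ∀ x, ‖p x‖ ≤ C

theorem IsBddMeas.mul {p q : X → ℂ} (hp : IsBddMeas p) (hq : IsBddMeas q) :
    IsBddMeas (fun x => p x * q x) := by
  obtain ⟨hp, C, hC⟩ := hp
  obtain ⟨hq, D, hD⟩ := hq
  refine ⟨hp.mul hq, C * D, fun x => ?_⟩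
  rw [norm_mul]
  exact mul_le_mul (hC x) (hD x) (norm_nonneg _) ((norm_nonneg _).trans (hC x))

theorem IsBddMeas.memLp {p : X → ℂ} (hp : IsBddMeas p) (g : Lp ℂ 2 μ) :
    MemLp (fun x => p x * g x) 2 μ := by
  obtain ⟨hp, C, hC⟩ := hp
  refine MemLp.of_le_mul (g := fun x => g x) (c := C) (Lp.memLp _)
    (hp.aestronglyMeasurable.mul (Lp.aestronglyMeasurable _)) ?_
  filter_upwards with x
  rw [norm_mul]
  exact mul_le_mul_of_nonneg_right (hC _) (norm_nonneg _)

theorem norm_toLp_mul_le {p : X → ℂ} (hp : IsBddMeas p) {C : ℝ} (hC : ∀ x, ‖p x‖ ≤ C)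
    (g : Lp ℂ 2 μ) : ‖(hp.memLp g).toLp _‖ ≤ C * ‖g‖ := by
  refine Lp.norm_le_mul_norm_of_ae_le_mul ?_
  filter_upwards [(hp.memLp g).coeFn_toLp] with x hx
  rw [hx, norm_mul]
  exact mul_le_mul_of_nonneg_right (hC x) (norm_nonneg _)

open Classical in
/-- Multiplication by a bounded measurable function, as an operator on `L²`. -/
def mulL2 (μ : Measure X) (p : X → ℂ) : Lp ℂ 2 μ →L[ℂ] Lp ℂ 2 μ :=
  -- The bound chosen here only serves continuity; `norm_mulL2_le` recovers any valid one. The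
  -- default `0` makes the operator total in `p`.
  if hp : IsBddMeas p then
    LinearMap.mkContinuous
      { toFun := fun g => (hp.memLp g).toLp _
        map_add' := by
          intro g h
          refine Lp.ext ?_
          filter_upwards [(hp.memLp (g + h)).coeFn_toLp, (hp.memLp g).coeFn_toLp,
            (hp.memLp h).coeFn_toLp, Lp.coeFn_add g h,
            Lp.coeFn_add ((hp.memLp g).toLp _) ((hp.memLp h).toLp _)] with x h1 h2 h3 h4 h5
          rw [h1, h5, Pi.add_apply, h2, h3, h4, Pi.add_apply, mul_add]
        map_smul' := by
          intro c g
          refine Lp.ext ?_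
          filter_upwards [(hp.memLp (c • g)).coeFn_toLp, (hp.memLp g).coeFn_toLp,
            Lp.coeFn_smul c g, Lp.coeFn_smul c ((hp.memLp g).toLp _)] with x h1 h2 h3 h4
          rw [RingHom.id_apply, h1, h4, Pi.smul_apply, h2, h3, Pi.smul_apply, smul_eq_mul,
            smul_eq_mul]
          ring } hp.2.choose (fun g => norm_toLp_mul_le hp hp.2.choose_spec g)
  else 0

theorem coeFn_mulL2 {p : X → ℂ} (hp : IsBddMeas p) (g : Lp ℂ 2 μ) :
    mulL2 μ p g =ᵐ[μ] fun x => p x * g x := by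
  rw [mulL2, dif_pos hp]
  exact (hp.memLp g).coeFn_toLp

theorem norm_mulL2_le {p : X → ℂ} (hp : Measurable p) {C : ℝ} (hC : ∀ x, ‖p x‖ ≤ C)
    (g : Lp ℂ 2 μ) : ‖mulL2 μ p g‖ ≤ C * ‖g‖ := by
  have h : IsBddMeas p := ⟨hp, C, hC⟩
  rw [mulL2, dif_pos h]
  exact norm_toLp_mul_le h hC g

theorem mulL2_mulL2 {p q : X → ℂ} (hp : IsBddMeas p) (hq : IsBddMeas q) (g : Lp ℂ 2 μ) :
    mulL2 μ p (mulL2 μ q g) = mulL2 μ (fun x => p x * q x) g := by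
  refine Lp.ext ?_
  filter_upwards [coeFn_mulL2 hp (mulL2 μ q g), coeFn_mulL2 hq g, coeFn_mulL2 (hp.mul hq) g]
    with x h1 h2 h3
  rw [h1, h2, h3, mul_assoc]

theorem mulL2_comm {p q : X → ℂ} (hp : IsBddMeas p) (hq : IsBddMeas q) (g : Lp ℂ 2 μ) :
    mulL2 μ p (mulL2 μ q g) = mulL2 μ q (mulL2 μ p g) := by
  rw [mulL2_mulL2 hp hq, mulL2_mulL2 hq hp]
  simp only [mul_comm]

/-- Real multipliers are self-adjoint. This moves the smoothing factor onto the test vector in the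
duality argument. -/
theorem inner_mulL2_ofReal {a : X → ℝ} (ha : IsBddMeas fun x => (a x : ℂ)) (g h : Lp ℂ 2 μ) :
    inner ℂ h (mulL2 μ (fun x => (a x : ℂ)) g) = inner ℂ (mulL2 μ (fun x => (a x : ℂ)) h) g := by
  rw [L2.inner_def, L2.inner_def]
  refine integral_congr_ae ?_
  filter_upwards [coeFn_mulL2 ha g, coeFn_mulL2 ha h] with x h1 h2
  rw [h1, h2]
  simp only [RCLike.inner_apply, map_mul, Complex.conj_ofReal]
  ring

theorem enorm_sq_eq_lintegral (g : Lp ℂ 2 μ) : ‖g‖ₑ ^ 2 = ∫⁻ x, ‖g x‖ₑ ^ 2 ∂μ := by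
  rw [Lp.enorm_def, eLpNorm_eq_lintegral_rpow_enorm_toReal two_ne_zero ENNReal.ofNat_ne_top,
    ← ENNReal.rpow_natCast, ← ENNReal.rpow_mul]
  simp

theorem enorm_mulL2_sq {p : X → ℂ} (hp : IsBddMeas p) (g : Lp ℂ 2 μ) :
    ‖mulL2 μ p g‖ₑ ^ 2 = ∫⁻ x, ‖p x‖ₑ ^ 2 * ‖g x‖ₑ ^ 2 ∂μ := by
  rw [enorm_sq_eq_lintegral]
  refine lintegral_congr_ae ?_
  filter_upwards [coeFn_mulL2 hp g] with x h1
  rw [h1, enorm_mul, mul_pow]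

/-- Multiplication operators are continuous in the strong operator topology with respect to bounded
pointwise convergence. -/
theorem tendsto_mulL2 {ι : Type*} {l : Filter ι} [l.IsCountablyGenerated] {p : ι → X → ℂ}
    {q : X → ℂ} (hp : ∀ i, Measurable (p i)) (hq : Measurable q) {C : ℝ} (hC : ∀ i x, ‖p i x‖ ≤ C)
    (hqC : ∀ x, ‖q x‖ ≤ C) (h : ∀ x, Tendsto (fun i => p i x) l (𝓝 (q x))) (g : Lp ℂ 2 μ) :
    Tendsto (fun i => mulL2 μ (p i) g) l (𝓝 (mulL2 μ q g)) := by
  have hpq : ∀ i, IsBddMeas (fun x => p i x - q x) := fun i => ⟨(hp i).sub hq, C + C, fun x =>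
    (norm_sub_le _ _).trans (add_le_add (hC i x) (hqC x))⟩
  have hsub : ∀ i, mulL2 μ (p i) g - mulL2 μ q g = mulL2 μ (fun x => p i x - q x) g := by
    intro i
    refine Lp.ext ?_
    filter_upwards [coeFn_mulL2 ⟨hp i, C, hC i⟩ g, coeFn_mulL2 ⟨hq, C, hqC⟩ g,
      coeFn_mulL2 (hpq i) g, Lp.coeFn_sub (mulL2 μ (p i) g) (mulL2 μ q g)] with x h1 h2 h3 h4
    rw [h4, Pi.sub_apply, h1, h2, h3, sub_mul]
  have hint : ∫⁻ x, (ENNReal.ofReal (C + C)) ^ 2 * ‖g x‖ₑ ^ 2 ∂μ ≠ ∞ := by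
    rw [lintegral_const_mul' _ _ (by finiteness), ← enorm_sq_eq_lintegral]
    finiteness
  -- Dominated convergence for $|p_i-q|^2|g|^2$ with majorant $(2C)^2|g|^2$.
  have key : Tendsto (fun i => ‖mulL2 μ (p i) g - mulL2 μ q g‖ₑ ^ 2) l (𝓝 0) := by
    have h0 : Tendsto (fun i => ∫⁻ x, ‖p i x - q x‖ₑ ^ 2 * ‖g x‖ₑ ^ 2 ∂μ) l
        (𝓝 (∫⁻ _, 0 ∂μ)) := by
      refine tendsto_lintegral_filter_of_dominated_convergence' _ (Eventually.of_forall fun i => ?_)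
        (Eventually.of_forall fun i => Eventually.of_forall fun x => ?_) hint ?_
      · exact (((hp i).sub hq).enorm.pow_const 2).aemeasurable.mul
          ((Lp.aestronglyMeasurable g).enorm.pow_const 2)
      · gcongr
        rw [← ofReal_norm]
        exact ENNReal.ofReal_le_ofReal ((norm_sub_le _ _).trans (add_le_add (hC i x) (hqC x)))
      · filter_upwards [] with x
        have h1 : Tendsto (fun i => ‖p i x - q x‖ₑ) l (𝓝 0) := by
          have := ((h x).sub_const (q x)).enorm
          simpa using this
        have h2 : Tendsto (fun i => ‖p i x - q x‖ₑ ^ 2) l (𝓝 0) := by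
          simpa using ENNReal.Tendsto.pow (n := 2) h1
        simpa using ENNReal.Tendsto.mul_const h2 (Or.inr (by finiteness : ‖g x‖ₑ ^ 2 ≠ ∞))
    simp only [lintegral_zero] at h0
    refine h0.congr fun i => ?_
    rw [hsub, enorm_mulL2_sq (hpq i)]
  rw [tendsto_iff_edist_tendsto_0]
  have h3 := key.ennrpow_const (1 / 2 : ℝ)
  simp only [edist_eq_enorm_sub]
  rw [ENNReal.zero_rpow_of_pos (by norm_num)] at h3
  refine h3.congr fun i => ?_
  rw [← ENNReal.rpow_natCast, ← ENNReal.rpow_mul]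
  norm_num

/-- Strong continuity in `t` and a Lipschitz bound in the vector, uniform in `t`, give joint
continuity. It makes integrands such as $\tau\mapsto p(t-\tau)f(\tau)$ strongly measurable for
merely measurable $f$. -/
theorem continuous_mulL2 {p : ℝ → X → ℂ} (hp : ∀ t, Measurable (p t)) {C : ℝ}
    (hC : ∀ t x, ‖p t x‖ ≤ C) (hc : ∀ x, Continuous fun t => p t x) :
    Continuous fun z : ℝ × Lp ℂ 2 μ => mulL2 μ (p z.1) z.2 := by
  refine continuous_prod_of_continuous_lipschitzWith' _ (Real.toNNReal C) (fun t => ?_) fun g => ?_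
  · refine LipschitzWith.of_dist_le_mul fun g h => ?_
    rw [dist_eq_norm, dist_eq_norm, ← map_sub]
    refine (norm_mulL2_le (hp t) (hC t) _).trans ?_
    gcongr
    exact Real.le_coe_toNNReal C
  · refine continuous_iff_continuousAt.2 fun t => ?_
    exact tendsto_mulL2 hp (hp t) hC (hC t) (fun x => (hc x).tendsto t) g

end Multiplication

/-! ### Square functions, duality and maximal regularity for bounded weights. -/

section Smoothing

open Filter Topology Set

variable {X : Type*} [MeasurableSpace X] {μ : Measure X}

/-- The function `a e^{-c a² σ / 2}`, for `σ ≥ 0`. -/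
def heatWeight (a : X → ℝ) (c σ : ℝ) (x : X) : ℝ := a x * Real.exp (-(c * a x ^ 2 * max σ 0) / 2)

/-- A nonnegative bounded measurable weight. -/
structure IsWeight (a : X → ℝ) : Prop where
  meas : Measurable a
  nonneg : ∀ x, 0 ≤ a x
  bdd : ∃ N : ℝ, ∀ x, a x ≤ N

theorem IsWeight.isBddMeas {a : X → ℝ} (ha : IsWeight a) : IsBddMeas fun x => (a x : ℂ) := by
  obtain ⟨N, hN⟩ := ha.bdd
  refine ⟨by have := ha.meas; fun_prop, N, fun x => ?_⟩
  rw [Complex.norm_real, Real.norm_of_nonneg (ha.nonneg x)]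
  exact hN x

theorem IsWeight.mul {a b : X → ℝ} (ha : IsWeight a) (hb : IsWeight b) :
    IsWeight fun x => a x * b x := by
  obtain ⟨N, hN⟩ := ha.bdd
  obtain ⟨M, hM⟩ := hb.bdd
  exact ⟨ha.meas.mul hb.meas, fun x => mul_nonneg (ha.nonneg x) (hb.nonneg x), N * M, fun x =>
    mul_le_mul (hN x) (hM x) (hb.nonneg x) ((ha.nonneg x).trans (hN x))⟩

theorem heatWeight_le {Y : Type*} {a : Y → ℝ} {c : ℝ} (hc : 0 < c) {x : Y} (hx : 0 ≤ a x) (σ : ℝ) :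
    heatWeight a c σ x ≤ a x := by
  refine mul_le_of_le_one_right hx (Real.exp_le_one_iff.2 ?_)
  have : 0 ≤ c * a x ^ 2 * max σ 0 := by positivity
  linarith

theorem IsWeight.heatWeight {a : X → ℝ} (ha : IsWeight a) {c : ℝ} (hc : 0 < c) (σ : ℝ) :
    IsWeight (heatWeight a c σ) := by
  obtain ⟨N, hN⟩ := ha.bdd
  refine ⟨?_, fun x => mul_nonneg (ha.nonneg x) (Real.exp_pos _).le, N, fun x =>
    (heatWeight_le hc (ha.nonneg x) σ).trans (hN x)⟩
  have := ha.meas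
  unfold NSK.heatWeight
  fun_prop

/-- The operator of multiplication by `a e^{-c a² σ / 2}`. -/
def heatOp (μ : Measure X) (a : X → ℝ) (c σ : ℝ) : Lp ℂ 2 μ →L[ℂ] Lp ℂ 2 μ :=
  mulL2 μ fun x => (heatWeight a c σ x : ℂ)

/-- The truncation `max σ 0` keeps the weight below `a` for negative times too, so no restriction on
the sign of time is needed. -/
theorem continuous_heatOp {a : X → ℝ} (ha : IsWeight a) {c : ℝ} (hc : 0 < c) :
    Continuous fun z : ℝ × Lp ℂ 2 μ => heatOp μ a c z.1 z.2 := by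
  obtain ⟨N, hN⟩ := ha.bdd
  refine continuous_mulL2 (fun t => (ha.heatWeight hc t).isBddMeas.1) (C := N) (fun t x => ?_)
    fun x => ?_
  · rw [Complex.norm_real, Real.norm_of_nonneg ((ha.heatWeight hc t).nonneg x)]
    exact (heatWeight_le hc (ha.nonneg x) t).trans (hN x)
  · unfold heatWeight; fun_prop

/-- $\int_0^\infty a^2e^{-ca^2\sigma}\,d\sigma$ equals $1/c$ for every $a>0$ and vanishes for $a=0$;
the independence of $a$ is the point. -/
theorem lintegral_heatWeight_sq_le {Y : Type*} {a : Y → ℝ} {c : ℝ} (hc : 0 < c) {x : Y} (hx : 0 ≤ a x) :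
    ∫⁻ σ in Ioi (0 : ℝ), ‖(heatWeight a c σ x : ℂ)‖ₑ ^ 2 ≤ ENNReal.ofReal (1 / c) := by
  rcases hx.eq_or_lt with h0 | hpos
  · simp [heatWeight, ← h0]
  have hb : 0 < c * a x ^ 2 := by positivity
  have hint := integral_exp_mul_Ioi (neg_neg_of_pos hb) 0
  have h1 : ∀ σ ∈ Ioi (0 : ℝ), ‖(heatWeight a c σ x : ℂ)‖ₑ ^ 2 =
      ENNReal.ofReal (a x ^ 2 * Real.exp (-(c * a x ^ 2) * σ)) := by
    intro σ hσ
    rw [← ofReal_norm, Complex.norm_real, ← ENNReal.ofReal_pow (norm_nonneg _), Real.norm_eq_abs,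
      sq_abs, heatWeight, max_eq_left (le_of_lt hσ), mul_pow, ← Real.exp_nat_mul]
    congr 3
    push_cast
    ring
  rw [setLIntegral_congr_fun measurableSet_Ioi h1, ← ofReal_integral_eq_lintegral_ofReal]
  · refine ENNReal.ofReal_le_ofReal ?_
    rw [integral_const_mul, hint]
    simp only [mul_zero, Real.exp_zero]
    rw [le_div_iff₀ hc]
    field_simp
    simp
  · exact (integrableOn_exp_mul_Ioi (neg_neg_of_pos hb) 0).const_mul _
  · exact Eventually.of_forall fun σ => by positivity

/-- The square function estimate for the heat-like family `a e^{-c a² σ / 2}`. -/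
theorem lintegral_heatOp_sq_le [SFinite μ] {a : X → ℝ} (ha : IsWeight a) {c : ℝ} (hc : 0 < c)
    (g : Lp ℂ 2 μ) :
    ∫⁻ σ in Ioi (0 : ℝ), ‖heatOp μ a c σ g‖ₑ ^ 2 ≤ ENNReal.ofReal (1 / c) * ‖g‖ₑ ^ 2 := by
  have h1 : ∀ σ, ‖heatOp μ a c σ g‖ₑ ^ 2 =
      ∫⁻ x, ‖(heatWeight a c σ x : ℂ)‖ₑ ^ 2 * ‖g x‖ₑ ^ 2 ∂μ := fun σ =>
    enorm_mulL2_sq (ha.heatWeight hc σ).isBddMeas g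
  simp only [h1]
  have hm : Measurable fun z : ℝ × X => ‖(heatWeight a c z.1 z.2 : ℂ)‖ₑ ^ 2 := by
    have := ha.meas
    unfold heatWeight
    fun_prop
  -- By Tonelli the time integral can be done first, at each fixed `x`.
  rw [lintegral_lintegral_swap, enorm_sq_eq_lintegral, ← lintegral_const_mul' _ _ (by finiteness)]
  · refine lintegral_mono fun x => ?_
    rw [lintegral_mul_const' _ _ (by finiteness)]
    gcongr
    exact lintegral_heatWeight_sq_le hc (ha.nonneg x)
  · refine hm.aemeasurable.mul ?_
    exact ((Lp.aestronglyMeasurable g).comp_snd.enorm.pow_const 2)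

theorem setLIntegral_Iio_sub_left (G : ℝ → ℝ≥0∞) (t : ℝ) :
    ∫⁻ τ in Iio t, G (t - τ) = ∫⁻ σ in Ioi (0 : ℝ), G σ := by
  rw [← lintegral_indicator measurableSet_Iio, ← lintegral_indicator measurableSet_Ioi,
    ← lintegral_sub_left_eq_self ((Ioi 0).indicator G) t]
  congr 1 with τ
  simp [indicator]

theorem setLIntegral_Ioi_sub_right (G : ℝ → ℝ≥0∞) (τ : ℝ) :
    ∫⁻ t in Ioi τ, G (t - τ) = ∫⁻ σ in Ioi (0 : ℝ), G σ := by
  rw [← lintegral_indicator measurableSet_Ioi, ← lintegral_indicator measurableSet_Ioi,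
    ← lintegral_sub_right_eq_self ((Ioi 0).indicator G) τ]
  congr 1 with t
  simp [indicator]

/-- A duality argument: a vector-valued integral `v` is bounded by square functions. -/
theorem enorm_integral_sq_le {H : Type*} [NormedAddCommGroup H] [InnerProductSpace ℂ H]
    [CompleteSpace H] {ν : Measure ℝ} {b : ℝ → H} (hb : Integrable b ν) {φ ψ : ℝ → ℝ≥0∞}
    (hφ : AEMeasurable φ ν) (hψ : AEMeasurable ψ ν) {K : ℝ≥0∞}
    (h : ∀ τ, ‖inner ℂ (∫ τ, b τ ∂ν) (b τ)‖ₑ ≤ φ τ * ψ τ)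
    (hK : ∫⁻ τ, ψ τ ^ 2 ∂ν ≤ K * ‖∫ τ, b τ ∂ν‖ₑ ^ 2) :
    ‖∫ τ, b τ ∂ν‖ₑ ^ 2 ≤ K * ∫⁻ τ, φ τ ^ 2 ∂ν := by
  set v := ∫ τ, b τ ∂ν with hv
  rcases eq_or_ne ‖v‖ₑ 0 with h0 | h0
  · simp [h0]
  have hsq : ∀ z : ℝ≥0∞, (z ^ (1 / 2 : ℝ)) ^ 2 = z := fun z => by
    rw [← ENNReal.rpow_natCast, ← ENNReal.rpow_mul]; norm_num
  -- $\|v\|^2=\int\langle v,b(\tau)\rangle\,d\nu$, followed by Cauchy–Schwarz in $\tau$. Squaring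
  -- and using `hK` leaves a factor $\|v\|^2$ on both sides, which is nonzero and finite and can be
  -- cancelled.
  have h1 : ‖v‖ₑ ^ 2 ≤ (∫⁻ τ, φ τ ^ 2 ∂ν) ^ (1 / 2 : ℝ) * (∫⁻ τ, ψ τ ^ 2 ∂ν) ^ (1 / 2 : ℝ) := by
    calc ‖v‖ₑ ^ 2 = ‖inner ℂ v v‖ₑ := by
          rw [inner_self_eq_norm_sq_to_K, enorm_pow]
          congr 1
          rw [← ofReal_norm, ← ofReal_norm]
          simp
      _ = ‖∫ τ, inner ℂ v (b τ) ∂ν‖ₑ := by rw [integral_inner hb]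
      _ ≤ ∫⁻ τ, ‖inner ℂ v (b τ)‖ₑ ∂ν := enorm_integral_le_lintegral_enorm _
      _ ≤ ∫⁻ τ, (φ * ψ) τ ∂ν := lintegral_mono h
      _ ≤ _ := by
        simpa using ENNReal.lintegral_mul_le_Lp_mul_Lq ν Real.HolderConjugate.two_two hφ hψ
  have h2 : ‖v‖ₑ ^ 2 * ‖v‖ₑ ^ 2 ≤ K * (∫⁻ τ, φ τ ^ 2 ∂ν) * ‖v‖ₑ ^ 2 := by
    calc ‖v‖ₑ ^ 2 * ‖v‖ₑ ^ 2 = (‖v‖ₑ ^ 2) ^ 2 := by ring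
      _ ≤ _ := pow_le_pow_left' h1 2
      _ = (∫⁻ τ, φ τ ^ 2 ∂ν) * ∫⁻ τ, ψ τ ^ 2 ∂ν := by rw [mul_pow, hsq, hsq]
      _ ≤ (∫⁻ τ, φ τ ^ 2 ∂ν) * (K * ‖v‖ₑ ^ 2) := by gcongr
      _ = _ := by ring
  exact (ENNReal.mul_le_mul_iff_left (by positivity) (by finiteness)).1 h2


/-- A family of multipliers decaying like `e^{-c w² t}` for `t ≥ 0`. -/
structure IsDecaying (w : X → ℝ) (C c : ℝ) (p : ℝ → X → ℂ) : Prop where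
  pos : 0 < c
  nonneg : 0 ≤ C
  meas : ∀ t, Measurable (p t)
  cont : ∀ x, Continuous fun t => p t x
  bound : ∀ t x, ‖p t x‖ ≤ C * Real.exp (-(c * w x ^ 2 * max t 0))

/-- The time convolution of a family of multipliers with a function. -/
def timeConv (μ : Measure X) (p : ℝ → X → ℂ) (f : ℝ → Lp ℂ 2 μ) (t : ℝ) : Lp ℂ 2 μ :=
  ∫ τ in (0 : ℝ)..t, mulL2 μ (p (t - τ)) (f τ)

namespace IsDecaying

variable {w : X → ℝ} {C c : ℝ} {p : ℝ → X → ℂ} (hp : IsDecaying w C c p)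
include hp

theorem norm_le (t : ℝ) (x : X) : ‖p t x‖ ≤ C := by
  have := hp.pos
  refine (hp.bound t x).trans (mul_le_of_le_one_right hp.nonneg (Real.exp_le_one_iff.2 ?_))
  have : 0 ≤ c * w x ^ 2 * max t 0 := by positivity
  linarith

theorem isBddMeas (t : ℝ) : IsBddMeas (p t) := ⟨hp.meas t, C, hp.norm_le t⟩

theorem continuous : Continuous fun z : ℝ × Lp ℂ 2 μ => mulL2 μ (p z.1) z.2 :=
  continuous_mulL2 hp.meas hp.norm_le hp.cont

theorem aestronglyMeasurable {f : ℝ → Lp ℂ 2 μ} {ν : Measure ℝ} (hf : AEStronglyMeasurable f ν)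
    (t : ℝ) : AEStronglyMeasurable (fun τ => mulL2 μ (p (t - τ)) (f τ)) ν :=
  hp.continuous.comp_aestronglyMeasurable
    ((continuous_const.sub continuous_id).aestronglyMeasurable.prodMk hf)

theorem integrable {f : ℝ → Lp ℂ 2 μ} {ν : Measure ℝ} (hf : Integrable f ν)
    (t : ℝ) : Integrable (fun τ => mulL2 μ (p (t - τ)) (f τ)) ν :=
  (hf.norm.const_mul C).mono' (hp.aestronglyMeasurable hf.1 t)
    (Eventually.of_forall fun _ => norm_mulL2_le (hp.meas _) (hp.norm_le _) _)

theorem mulL2_integral {f : ℝ → Lp ℂ 2 μ} {ν : Measure ℝ} (hf : Integrable f ν)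
    {a : X → ℂ} (ha : IsBddMeas a) (t : ℝ) :
    mulL2 μ a (∫ τ, mulL2 μ (p (t - τ)) (f τ) ∂ν) =
      ∫ τ, mulL2 μ (p (t - τ)) (mulL2 μ a (f τ)) ∂ν := by
  rw [← ContinuousLinearMap.integral_comp_comm _ (hp.integrable hf t)]
  simp only [mulL2_comm ha (hp.isBddMeas _)]

/-- A decaying family is a bounded multiple of `e^{-c a² t k / 2}`, `k = 1, 2`. -/
theorem isBddMeas_mul_exp {a : X → ℝ} (ha : IsWeight a) (haw : ∀ x, a x ≤ w x) (t : ℝ) {k : ℝ}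
    (hk : k ≤ 2) :
    Measurable (fun x => p t x * (Real.exp (k * (c * a x ^ 2 * max t 0) / 2) : ℂ)) ∧
      ∀ x, ‖p t x * (Real.exp (k * (c * a x ^ 2 * max t 0) / 2) : ℂ)‖ ≤ C := by
  have h1 := ha.meas
  have h2 := hp.meas t
  have hc := hp.pos
  refine ⟨by fun_prop, fun x => ?_⟩
  rw [norm_mul, Complex.norm_real, Real.norm_of_nonneg (Real.exp_pos _).le]
  refine (mul_le_mul_of_nonneg_right (hp.bound t x) (Real.exp_pos _).le).trans ?_
  rw [mul_assoc, ← Real.exp_add]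
  refine mul_le_of_le_one_right hp.nonneg (Real.exp_le_one_iff.2 ?_)
  -- As $0\le a\le w$ and $k\le2$, the growth rate $kca^2/2$ never exceeds the decay rate $cw^2$.
  have h3 : c * a x ^ 2 * max t 0 ≤ c * w x ^ 2 * max t 0 := by
    have := ha.nonneg x
    have := haw x
    gcongr
  have h4 : 0 ≤ c * a x ^ 2 * max t 0 := by positivity
  nlinarith

/-- Factor $pa=(ae^{-ca^2t/2})(pe^{ca^2t/2})$: the second factor is bounded by $C$, the first is
real and passes to `h`. -/
theorem enorm_inner_le {a : X → ℝ} (ha : IsWeight a) (haw : ∀ x, a x ≤ w x) (t : ℝ)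
    (g h : Lp ℂ 2 μ) :
    ‖inner ℂ h (mulL2 μ (p t) (mulL2 μ (fun x => (a x : ℂ)) g))‖ₑ ≤
      (ENNReal.ofReal C * ‖g‖ₑ) * ‖heatOp μ a c t h‖ₑ := by
  obtain ⟨hq, hqC⟩ := hp.isBddMeas_mul_exp ha haw t one_le_two
  have hw := (ha.heatWeight hp.pos t).isBddMeas
  have heq : mulL2 μ (p t) (mulL2 μ (fun x => (a x : ℂ)) g) =
      mulL2 μ (fun x => (heatWeight a c t x : ℂ)) (mulL2 μ
        (fun x => p t x * (Real.exp (1 * (c * a x ^ 2 * max t 0) / 2) : ℂ)) g) := by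
    rw [mulL2_mulL2 (hp.isBddMeas t) ha.isBddMeas, mulL2_mulL2 hw ⟨hq, C, hqC⟩]
    congr 2 with x
    rw [heatWeight, neg_div, Real.exp_neg, one_mul]
    push_cast
    field_simp
  rw [heq, inner_mulL2_ofReal hw, ← ofReal_norm, ← ofReal_norm, ← ofReal_norm,
    ← ENNReal.ofReal_mul hp.nonneg,
    ← ENNReal.ofReal_mul (mul_nonneg hp.nonneg (norm_nonneg _)), mul_comm]
  refine ENNReal.ofReal_le_ofReal ((norm_inner_le_norm _ _).trans ?_)
  exact mul_le_mul_of_nonneg_left (norm_mulL2_le hq hqC g) (norm_nonneg _)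

/-- Now $pa^2=(ae^{-ca^2t/2})(pe^{ca^2t})(ae^{-ca^2t/2})$: the whole decay of $p$ is spent, half of
it on `g` and half on `h`. -/
theorem enorm_inner_sq_le {a : X → ℝ} (ha : IsWeight a) (haw : ∀ x, a x ≤ w x) (t : ℝ)
    (g h : Lp ℂ 2 μ) :
    ‖inner ℂ h (mulL2 μ (p t) (mulL2 μ (fun x => ((a x * a x : ℝ) : ℂ)) g))‖ₑ ≤
      (ENNReal.ofReal C * ‖heatOp μ a c t g‖ₑ) * ‖heatOp μ a c t h‖ₑ := by
  obtain ⟨hq, hqC⟩ := hp.isBddMeas_mul_exp ha haw t le_rfl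
  have hw := (ha.heatWeight hp.pos t).isBddMeas
  have heq : mulL2 μ (p t) (mulL2 μ (fun x => ((a x * a x : ℝ) : ℂ)) g) =
      mulL2 μ (fun x => (heatWeight a c t x : ℂ)) (mulL2 μ
        (fun x => p t x * (Real.exp (2 * (c * a x ^ 2 * max t 0) / 2) : ℂ)) (heatOp μ a c t g)) := by
    rw [heatOp, mulL2_mulL2 (hp.isBddMeas t) (ha.mul ha).isBddMeas,
      mulL2_mulL2 ⟨hq, C, hqC⟩ hw, mulL2_mulL2 hw (IsBddMeas.mul ⟨hq, C, hqC⟩ hw)]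
    congr 2 with x
    have h2 : Real.exp (2 * (c * a x ^ 2 * max t 0) / 2) =
        Real.exp (c * a x ^ 2 * max t 0 / 2) * Real.exp (c * a x ^ 2 * max t 0 / 2) := by
      rw [← Real.exp_add]
      ring_nf
    rw [h2, heatWeight, neg_div, Real.exp_neg]
    push_cast
    field_simp
  rw [heq, inner_mulL2_ofReal hw, ← ofReal_norm, ← ofReal_norm, ← ofReal_norm,
    ← ENNReal.ofReal_mul hp.nonneg,
    ← ENNReal.ofReal_mul (mul_nonneg hp.nonneg (norm_nonneg _)), mul_comm]
  refine ENNReal.ofReal_le_ofReal ((norm_inner_le_norm _ _).trans ?_)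
  exact mul_le_mul_of_nonneg_left (norm_mulL2_le hq hqC _) (norm_nonneg _)

omit hp in
theorem timeConv_eq {f : ℝ → Lp ℂ 2 μ} {t : ℝ} (ht : 0 ≤ t) :
    timeConv μ p f t = ∫ τ in Ioo 0 t, mulL2 μ (p (t - τ)) (f τ) := by
  rw [timeConv, intervalIntegral.integral_of_le ht, integral_Ioc_eq_integral_Ioo]

omit hp in
theorem aemeasurable_heatOp {a : X → ℝ} (ha : IsWeight a) (hc : 0 < c) {f : ℝ → Lp ℂ 2 μ}
    {ν : Measure ℝ} (hf : AEStronglyMeasurable f ν) (t : ℝ) :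
    AEMeasurable (fun τ => ‖heatOp μ a c (t - τ) (f τ)‖ₑ) ν :=
  ((continuous_heatOp ha hc).comp_aestronglyMeasurable
    ((continuous_const.sub continuous_id).aestronglyMeasurable.prodMk hf)).enorm

omit hp in
theorem lintegral_heatOp_sub_left_le [SFinite μ] {a : X → ℝ} (ha : IsWeight a)
    (hc : 0 < c) (g : Lp ℂ 2 μ) (t : ℝ) :
    ∫⁻ τ in Ioo 0 t, ‖heatOp μ a c (t - τ) g‖ₑ ^ 2 ≤ ENNReal.ofReal (1 / c) * ‖g‖ₑ ^ 2 :=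
  calc _ ≤ ∫⁻ τ in Iio t, ‖heatOp μ a c (t - τ) g‖ₑ ^ 2 :=
        lintegral_mono_set Ioo_subset_Iio_self
    _ = ∫⁻ σ in Ioi (0 : ℝ), ‖heatOp μ a c σ g‖ₑ ^ 2 :=
        setLIntegral_Iio_sub_left (fun σ => ‖heatOp μ a c σ g‖ₑ ^ 2) t
    _ ≤ _ := lintegral_heatOp_sq_le ha hc g

/-- Duality with the weighted convolution as its own test vector; the square function bound in
$\tau$ supplies the constant $1/c$. -/
theorem enorm_mulL2_timeConv_sq_le [SFinite μ] {a : X → ℝ} (ha : IsWeight a)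
    (haw : ∀ x, a x ≤ w x) {f : ℝ → Lp ℂ 2 μ} {t : ℝ} (ht : 0 ≤ t)
    (hf : IntegrableOn f (Ioo 0 t)) :
    ‖mulL2 μ (fun x => (a x : ℂ)) (timeConv μ p f t)‖ₑ ^ 2 ≤
      ENNReal.ofReal (1 / c) * ∫⁻ τ in Ioo 0 t, (ENNReal.ofReal C * ‖f τ‖ₑ) ^ 2 := by
  rw [timeConv_eq ht, hp.mulL2_integral hf ha.isBddMeas]
  refine enorm_integral_sq_le (hp.integrable
    (ContinuousLinearMap.integrable_comp (mulL2 μ _) hf) t) (hf.1.enorm.const_mul _)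
    (aemeasurable_heatOp ha hp.pos aestronglyMeasurable_const t)
    (fun τ => hp.enorm_inner_le ha haw (t - τ) (f τ) _)
    (lintegral_heatOp_sub_left_le ha hp.pos _ t)

/-- The same duality with two powers of the weight. The smoothing factor kept on $f(\tau)$ is what
makes the right side integrable in $t$. -/
theorem enorm_mulL2_sq_timeConv_sq_le [SFinite μ] {a : X → ℝ} (ha : IsWeight a)
    (haw : ∀ x, a x ≤ w x) {f : ℝ → Lp ℂ 2 μ} {t : ℝ} (ht : 0 ≤ t)
    (hf : IntegrableOn f (Ioo 0 t)) :
    ‖mulL2 μ (fun x => ((a x * a x : ℝ) : ℂ)) (timeConv μ p f t)‖ₑ ^ 2 ≤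
      ENNReal.ofReal (1 / c) *
        ∫⁻ τ in Ioo 0 t, (ENNReal.ofReal C * ‖heatOp μ a c (t - τ) (f τ)‖ₑ) ^ 2 := by
  rw [timeConv_eq ht, hp.mulL2_integral hf (ha.mul ha).isBddMeas]
  refine enorm_integral_sq_le (hp.integrable
    (ContinuousLinearMap.integrable_comp (mulL2 μ _) hf) t)
    ((aemeasurable_heatOp ha hp.pos hf.1 t).const_mul _)
    (aemeasurable_heatOp ha hp.pos aestronglyMeasurable_const t)
    (fun τ => hp.enorm_inner_sq_le ha haw (t - τ) (f τ) _)
    (lintegral_heatOp_sub_left_le ha hp.pos _ t)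

/-- Maximal regularity: the time convolution gains two powers of the weight in `L²` in time. -/
theorem lintegral_mulL2_sq_timeConv_sq_le [SFinite μ] {a : X → ℝ} (ha : IsWeight a)
    (haw : ∀ x, a x ≤ w x) {f : ℝ → Lp ℂ 2 μ} {T : ℝ} (hf : IntegrableOn f (Ioo 0 T)) :
    ∫⁻ t in Ioo 0 T, ‖mulL2 μ (fun x => ((a x * a x : ℝ) : ℂ)) (timeConv μ p f t)‖ₑ ^ 2 ≤
      ENNReal.ofReal (C / c) ^ 2 * ∫⁻ τ in Ioo 0 T, ‖f τ‖ₑ ^ 2 := by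
  have hc := hp.pos
  set ν := volume.restrict (Ioo 0 T) with hν
  -- Extending by zero outside the triangle $\tau<t$ gives an integrand on the full square, where
  -- Tonelli applies.
  let G : ℝ → ℝ → ℝ≥0∞ := fun t τ =>
    {z : ℝ × ℝ | z.2 < z.1}.indicator (fun z => ‖heatOp μ a c (z.1 - z.2) (f z.2)‖ₑ ^ 2) (t, τ)
  have hf2 : AEStronglyMeasurable (fun z : ℝ × ℝ => f z.2) (ν.prod ν) := hf.1.comp_snd
  have hE : AEStronglyMeasurable (fun z : ℝ × ℝ => heatOp μ a c (z.1 - z.2) (f z.2))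
      (ν.prod ν) :=
    (continuous_heatOp ha hc).comp_aestronglyMeasurable (f := fun z : ℝ × ℝ => (z.1 - z.2, f z.2))
      ((continuous_fst.sub continuous_snd).aestronglyMeasurable.prodMk hf2)
  have hG : AEMeasurable (Function.uncurry G) (ν.prod ν) :=
    (hE.enorm.pow_const 2).indicator (measurableSet_lt measurable_snd measurable_fst)
  have h1 : ∀ t ∈ Ioo 0 T, ‖mulL2 μ (fun x => ((a x * a x : ℝ) : ℂ)) (timeConv μ p f t)‖ₑ ^ 2 ≤
      ENNReal.ofReal (1 / c) * ENNReal.ofReal C ^ 2 * ∫⁻ τ, G t τ ∂ν := by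
    intro t ht
    refine (hp.enorm_mulL2_sq_timeConv_sq_le ha haw ht.1.le
      (hf.mono_set (Ioo_subset_Ioo_right ht.2.le))).trans ?_
    simp only [mul_pow]
    rw [lintegral_const_mul' _ _ (by finiteness), ← mul_assoc]
    refine mul_le_mul' le_rfl ?_
    rw [← lintegral_indicator measurableSet_Ioo, hν, ← lintegral_indicator measurableSet_Ioo]
    refine lintegral_mono fun τ => ?_
    by_cases h : τ ∈ Ioo 0 t
    · have h' : τ ∈ Ioo 0 T := ⟨h.1, h.2.trans ht.2⟩
      simp [G, indicator, h.1, h.2, h'.2]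
    · simp [indicator_of_notMem h]
  -- Second use of the square function bound, in $t$ for fixed $\tau$; with the first it produces
  -- the factor $c^{-2}$.
  have h2 : ∀ τ, ∫⁻ t, G t τ ∂ν ≤ ENNReal.ofReal (1 / c) * ‖f τ‖ₑ ^ 2 := by
    intro τ
    calc ∫⁻ t, G t τ ∂ν ≤ ∫⁻ t, G t τ := lintegral_mono' Measure.restrict_le_self le_rfl
      _ = ∫⁻ t in Ioi τ, ‖heatOp μ a c (t - τ) (f τ)‖ₑ ^ 2 := by
        rw [← lintegral_indicator measurableSet_Ioi]
        rfl
      _ = ∫⁻ σ in Ioi (0 : ℝ), ‖heatOp μ a c σ (f τ)‖ₑ ^ 2 :=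
        setLIntegral_Ioi_sub_right (fun σ => ‖heatOp μ a c σ (f τ)‖ₑ ^ 2) τ
      _ ≤ _ := lintegral_heatOp_sq_le ha hc (f τ)
  calc _ ≤ ∫⁻ t, ENNReal.ofReal (1 / c) * ENNReal.ofReal C ^ 2 * ∫⁻ τ, G t τ ∂ν ∂ν :=
        setLIntegral_mono' measurableSet_Ioo h1
    _ = ENNReal.ofReal (1 / c) * ENNReal.ofReal C ^ 2 * ∫⁻ τ, ∫⁻ t, G t τ ∂ν ∂ν := by
        rw [lintegral_const_mul' _ _ (by finiteness), lintegral_lintegral_swap hG]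
    _ ≤ ENNReal.ofReal (1 / c) * ENNReal.ofReal C ^ 2 *
          ∫⁻ τ, ENNReal.ofReal (1 / c) * ‖f τ‖ₑ ^ 2 ∂ν := by
        gcongr with τ
        exact h2 τ
    _ = _ := by
        rw [lintegral_const_mul' _ _ (by finiteness), div_eq_mul_one_div C c,
          ENNReal.ofReal_mul hp.nonneg]
        ring

end IsDecaying

end Smoothing

/-! ### Passage to unbounded weights. -/

section Weighted

open Filter Topology Set

variable {X : Type*} [MeasurableSpace X] {μ : Measure X}

theorem eLpNorm_two_sq {α H : Type*} [MeasurableSpace α] [NormedAddCommGroup H] (f : α → H)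
    (ν : Measure α) : eLpNorm f 2 ν ^ 2 = ∫⁻ a, ‖f a‖ₑ ^ 2 ∂ν := by
  rw [eLpNorm_eq_lintegral_rpow_enorm_toReal two_ne_zero ENNReal.ofNat_ne_top,
    ← ENNReal.rpow_natCast, ← ENNReal.rpow_mul]
  simp

/-- The indicator function of `{w ≤ N}`. -/
def cutoff (w : X → ℝ) (N : ℕ) (x : X) : ℝ := {x | w x ≤ N}.indicator 1 x

theorem cutoff_of_le {Y : Type*} {w : Y → ℝ} {N : ℕ} {x : Y} (h : w x ≤ N) : cutoff w N x = 1 := by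
  simp [cutoff, h]

theorem cutoff_of_lt {Y : Type*} {w : Y → ℝ} {N : ℕ} {x : Y} (h : N < w x) : cutoff w N x = 0 := by
  simp [cutoff, h]

theorem cutoff_mul_self {Y : Type*} (w : Y → ℝ) (N : ℕ) (x : Y) :
    cutoff w N x * cutoff w N x = cutoff w N x := by
  rcases le_or_gt (w x) N with h | h
  · simp [cutoff_of_le h]
  · simp [cutoff_of_lt h]

theorem eventually_cutoff_eq_one {Y : Type*} (w : Y → ℝ) (x : Y) :
    ∀ᶠ N in atTop, cutoff w N x = 1 := by
  obtain ⟨M, hM⟩ := exists_nat_ge (w x)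
  filter_upwards [eventually_ge_atTop M] with N hN
  exact cutoff_of_le (hM.trans (by exact_mod_cast hN))

theorem isWeight_cutoff {w : X → ℝ} (hw : Measurable w) (N : ℕ) : IsWeight (cutoff w N) := by
  have h : ∀ x, cutoff w N x = 0 ∨ cutoff w N x = 1 := fun x =>
    (le_or_gt (w x) N).symm.imp cutoff_of_lt cutoff_of_le
  refine ⟨measurable_one.indicator (measurableSet_le hw measurable_const), fun x => ?_, 1,
    fun x => ?_⟩
  · rcases h x with h | h <;> simp [h]
  · rcases h x with h | h <;> simp [h]

theorem norm_cutoff_le {Y : Type*} (w : Y → ℝ) (N : ℕ) (x : Y) : ‖(cutoff w N x : ℂ)‖ ≤ 1 := by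
  rcases le_or_gt (w x) N with h | h
  · simp [cutoff_of_le h]
  · simp [cutoff_of_lt h]

theorem norm_one_sub_cutoff_le {Y : Type*} (w : Y → ℝ) (N : ℕ) (x : Y) :
    ‖(1 - cutoff w N x : ℂ)‖ ≤ 1 := by
  rcases le_or_gt (w x) N with h | h
  · simp [cutoff_of_le h]
  · simp [cutoff_of_lt h]

theorem isWeight_cutoff_mul {w : X → ℝ} (hw : Measurable w) (hw0 : ∀ x, 0 ≤ w x) (N : ℕ) :
    IsWeight fun x => cutoff w N x * w x := by
  have h := isWeight_cutoff hw N
  refine ⟨h.meas.mul hw, fun x => mul_nonneg (h.nonneg x) (hw0 x), N, fun x => ?_⟩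
  rcases le_or_gt (w x) N with h | h
  · simp [cutoff_of_le h, h]
  · simp [cutoff_of_lt h]

theorem cutoff_mul_le {Y : Type*} {w : Y → ℝ} (hw0 : ∀ x, 0 ≤ w x) (N : ℕ) (x : Y) :
    cutoff w N x * w x ≤ w x := by
  rcases le_or_gt (w x) N with h | h
  · simp [cutoff_of_le h]
  · simp [cutoff_of_lt h, hw0 x]

/-- If the truncations of `v g` stay bounded in `L²` then `v g ∈ L²`, and they converge to it. -/
theorem exists_eq_mul {w v : X → ℝ} (hw : Measurable w) (hv : Measurable v)
    (hvw : ∀ N, IsWeight fun x => cutoff w N x * v x) (g : Lp ℂ 2 μ)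
    (hB : liminf (fun N : ℕ => ‖mulL2 μ (fun x => ((cutoff w N x * v x : ℝ) : ℂ)) g‖ₑ ^ 2) atTop
      ≠ ∞) :
    ∃ G : Lp ℂ 2 μ, (G =ᵐ[μ] fun x => v x * g x) ∧
      ‖G‖ₑ ^ 2 ≤ liminf (fun N : ℕ =>
        ‖mulL2 μ (fun x => ((cutoff w N x * v x : ℝ) : ℂ)) g‖ₑ ^ 2) atTop ∧
      Tendsto (fun N : ℕ => mulL2 μ (fun x => ((cutoff w N x * v x : ℝ) : ℂ)) g) atTop (𝓝 G) := by
  have hmeas : AEStronglyMeasurable (fun x => (v x : ℂ) * g x) μ :=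
    (Complex.measurable_ofReal.comp hv).aestronglyMeasurable.mul (Lp.aestronglyMeasurable g)
  -- Fatou's lemma: at each point the cutoff is eventually $1$.
  have hle : ∫⁻ x, ‖(v x : ℂ) * g x‖ₑ ^ 2 ∂μ ≤ liminf (fun N : ℕ =>
      ‖mulL2 μ (fun x => ((cutoff w N x * v x : ℝ) : ℂ)) g‖ₑ ^ 2) atTop := by
    have h1 : ∀ N : ℕ, ‖mulL2 μ (fun x => ((cutoff w N x * v x : ℝ) : ℂ)) g‖ₑ ^ 2 =
        ∫⁻ x, ‖(cutoff w N x * v x : ℝ)‖ₑ ^ 2 * ‖g x‖ₑ ^ 2 ∂μ := by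
      intro N
      rw [enorm_mulL2_sq (hvw N).isBddMeas]
      congr 1 with x
      rw [← ofReal_norm, Complex.norm_real, ofReal_norm]
    simp only [h1]
    refine le_trans (lintegral_mono fun x => ?_) (lintegral_liminf_le' fun N => ?_)
    · refine le_liminf_of_le (by isBoundedDefault) ?_
      filter_upwards [eventually_cutoff_eq_one w x] with N hN
      rw [hN, one_mul, enorm_mul, mul_pow, ← ofReal_norm, Complex.norm_real, ofReal_norm]
    · exact ((hvw N).meas.enorm.pow_const 2).aemeasurable.mul
        ((Lp.aestronglyMeasurable g).enorm.pow_const 2)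
  have hmem : MemLp (fun x => (v x : ℂ) * g x) 2 μ := by
    refine ⟨hmeas, ?_⟩
    have h2 : eLpNorm (fun x => (v x : ℂ) * g x) 2 μ ^ 2 < ∞ := by
      rw [eLpNorm_two_sq]
      exact hle.trans_lt hB.lt_top
    by_contra h3
    rw [not_lt, top_le_iff] at h3
    simp [h3] at h2
  refine ⟨hmem.toLp _, hmem.coeFn_toLp, ?_, ?_⟩
  · rw [Lp.enorm_toLp, eLpNorm_two_sq]
    exact hle
  · have h3 := fun N : ℕ => (isWeight_cutoff hw N).isBddMeas
    -- Once $vg\in L^2$ is known, its truncations are cutoffs of a fixed $L^2$ function, so they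
    -- converge in norm.
    have h4 : ∀ N : ℕ, mulL2 μ (fun x => ((cutoff w N x * v x : ℝ) : ℂ)) g =
        mulL2 μ (fun x => (cutoff w N x : ℂ)) (hmem.toLp _) := by
      intro N
      refine Lp.ext ?_
      filter_upwards [coeFn_mulL2 (hvw N).isBddMeas g, coeFn_mulL2 (h3 N) (hmem.toLp _),
        hmem.coeFn_toLp] with x h5 h6 h7
      rw [h5, h6, h7]
      push_cast
      ring
    simp only [h4]
    have h5 : mulL2 μ (fun _ : X => (1 : ℂ)) (hmem.toLp _) = hmem.toLp _ := by
      refine Lp.ext ?_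
      filter_upwards [coeFn_mulL2 (p := fun _ : X => (1 : ℂ)) (μ := μ)
        ⟨measurable_const, 1, by simp⟩ (hmem.toLp _)] with x h6
      rw [h6, one_mul]
    nth_rewrite 2 [← h5]
    refine tendsto_mulL2 (fun N => (h3 N).1) measurable_const (norm_cutoff_le w)
      (by simp) (fun x => ?_) _
    refine tendsto_const_nhds.congr' ?_
    filter_upwards [eventually_cutoff_eq_one w x] with N hN
    simp [hN]

/-- For each $\tau$ the tail of $f(\tau)$ tends to zero in norm, and it is dominated by
$\|f(\tau)\|$. This will give convergence of the truncations uniformly in time. -/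
theorem tendsto_lintegral_tail {w : X → ℝ} (hw : Measurable w) {f : ℝ → Lp ℂ 2 μ} {ν : Measure ℝ}
    (hf : MemLp f 2 ν) :
    Tendsto (fun N : ℕ => ∫⁻ τ, ‖mulL2 μ (fun x => (1 - cutoff w N x : ℂ)) (f τ)‖ₑ ^ 2 ∂ν) atTop
      (𝓝 0) := by
  have hm : ∀ N : ℕ, Measurable fun x => (1 - cutoff w N x : ℂ) := fun N =>
    measurable_const.sub (isWeight_cutoff hw N).isBddMeas.1
  have h0 : mulL2 μ (fun _ : X => (0 : ℂ)) = 0 := by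
    refine ContinuousLinearMap.ext fun g => ?_
    have := norm_mulL2_le (μ := μ) (p := fun _ : X => (0 : ℂ)) measurable_const (C := 0)
      (by simp) g
    rw [zero_mul, norm_le_zero_iff] at this
    rw [this, zero_apply]
  rw [← lintegral_zero (μ := ν) (α := ℝ)]
  refine tendsto_lintegral_filter_of_dominated_convergence' (fun τ => ‖f τ‖ₑ ^ 2)
    (Eventually.of_forall fun N => ?_) (Eventually.of_forall fun N => Eventually.of_forall
      fun τ => ?_) ?_ ?_
  · exact ((mulL2 μ _).continuous.comp_aestronglyMeasurable hf.1).enorm.pow_const 2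
  · refine pow_le_pow_left' ?_ 2
    rw [← ofReal_norm, ← ofReal_norm]
    refine ENNReal.ofReal_le_ofReal ?_
    simpa using norm_mulL2_le (hm N) (norm_one_sub_cutoff_le w N) (f τ)
  · rw [← eLpNorm_two_sq]
    exact ENNReal.pow_ne_top hf.2.ne
  · filter_upwards [] with τ
    have h1 : Tendsto (fun N : ℕ => mulL2 μ (fun x => (1 - cutoff w N x : ℂ)) (f τ)) atTop
        (𝓝 (mulL2 μ (fun _ : X => (0 : ℂ)) (f τ))) := by
      refine tendsto_mulL2 hm measurable_const (norm_one_sub_cutoff_le w)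
        (by simp) (fun x => ?_) _
      refine tendsto_const_nhds.congr' ?_
      filter_upwards [eventually_cutoff_eq_one w x] with N hN
      simp [hN]
    rw [h0, zero_apply] at h1
    simpa using ENNReal.Tendsto.pow (n := 2) h1.enorm

namespace IsDecaying

variable {w : X → ℝ} {C c : ℝ} {p : ℝ → X → ℂ} (hp : IsDecaying w C c p)
include hp

/-- Extending the integrand by zero for $\tau\ge t$ fixes the domain of integration. For each $\tau$
it is then continuous in $t$ except at $t=\tau$, so dominated convergence applies at every time. -/
theorem continuousOn_timeConv {f : ℝ → Lp ℂ 2 μ} {T : ℝ} (hf : IntegrableOn f (Ioo 0 T)) :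
    ContinuousOn (timeConv μ p f) (Icc 0 T) := by
  set ν := volume.restrict (Ioo 0 T) with hν
  let F : ℝ → ℝ → Lp ℂ 2 μ := fun t => (Iio t).indicator fun τ => mulL2 μ (p (t - τ)) (f τ)
  have hF : ∀ t ∈ Icc 0 T, timeConv μ p f t = ∫ τ, F t τ ∂ν := by
    intro t ht
    rw [timeConv_eq ht.1, integral_indicator measurableSet_Iio, hν,
      Measure.restrict_restrict measurableSet_Iio]
    congr 2
    ext τ
    simp only [mem_Ioo, mem_inter_iff, mem_Iio]
    exact ⟨fun h => ⟨h.2, h.1, h.2.trans_le ht.2⟩, fun h => ⟨h.2.1, h.1⟩⟩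
  refine ContinuousOn.congr (Continuous.continuousOn ?_) hF
  refine continuous_iff_continuousAt.2 fun t₀ => ?_
  refine continuousAt_of_dominated (bound := fun τ => C * ‖f τ‖) (Eventually.of_forall fun t => ?_)
    (Eventually.of_forall fun t => Eventually.of_forall fun τ => ?_) (hf.norm.const_mul C) ?_
  · exact (hp.aestronglyMeasurable hf.1 t).indicator measurableSet_Iio
  · refine (norm_indicator_le_norm_self _ _).trans ?_
    exact norm_mulL2_le (hp.meas _) (hp.norm_le _) _
  · have h0 : ∀ᵐ τ ∂ν, τ ≠ t₀ := by
      refine ae_restrict_of_ae ?_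
      simp [ae_iff]
    filter_upwards [h0] with τ hτ
    rcases hτ.lt_or_gt with h | h
    · have h1 : ContinuousAt (fun t => mulL2 μ (p (t - τ)) (f τ)) t₀ :=
        (hp.continuous.comp ((continuous_id.sub continuous_const).prodMk
          continuous_const)).continuousAt
      refine h1.congr ?_
      filter_upwards [lt_mem_nhds h] with t ht
      simp [F, ht]
    · refine continuousAt_const.congr (f := fun _ => (0 : Lp ℂ 2 μ)) ?_
      filter_upwards [gt_mem_nhds h] with t ht
      simp [F, ht.not_gt]

variable [SFinite μ]

/-- The bound depends neither on the bounded weight $a\le w$ nor on $t$, which is what the removal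
of the truncation requires. -/
theorem enorm_mulL2_timeConv_sq_le' {a : X → ℝ} (ha : IsWeight a)
    (haw : ∀ x, a x ≤ w x) {f : ℝ → Lp ℂ 2 μ} {t T : ℝ} (ht : t ∈ Icc 0 T)
    (hf : IntegrableOn f (Ioo 0 T)) :
    ‖mulL2 μ (fun x => (a x : ℂ)) (timeConv μ p f t)‖ₑ ^ 2 ≤
      ENNReal.ofReal (C / √c) ^ 2 * ∫⁻ τ in Ioo 0 T, ‖f τ‖ₑ ^ 2 := by
  have hsub : Ioo 0 t ⊆ Ioo 0 T := Ioo_subset_Ioo_right ht.2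
  refine (hp.enorm_mulL2_timeConv_sq_le ha haw ht.1 (hf.mono_set hsub)).trans ?_
  simp only [mul_pow]
  rw [lintegral_const_mul' _ _ (by finiteness), ← mul_assoc]
  refine mul_le_mul' (le_of_eq ?_) (lintegral_mono_set hsub)
  rw [← ENNReal.ofReal_pow hp.nonneg, ← ENNReal.ofReal_mul (by have := hp.pos; positivity),
    ← ENNReal.ofReal_pow (div_nonneg hp.nonneg (Real.sqrt_nonneg _)), div_pow,
    Real.sq_sqrt hp.pos.le]
  congr 1
  ring

theorem exists_eq_mul_timeConv (hw : Measurable w) (hw0 : ∀ x, 0 ≤ w x) {f : ℝ → Lp ℂ 2 μ}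
    {t T : ℝ} (ht : t ∈ Icc 0 T) (hf : MemLp f 2 (volume.restrict (Ioo 0 T))) :
    ∃ G : Lp ℂ 2 μ, (G =ᵐ[μ] fun x => w x * timeConv μ p f t x) ∧
      ‖G‖ₑ ^ 2 ≤ ENNReal.ofReal (C / √c) ^ 2 * ∫⁻ τ in Ioo 0 T, ‖f τ‖ₑ ^ 2 := by
  have hle : liminf (fun N : ℕ => ‖mulL2 μ (fun x => ((cutoff w N x * w x : ℝ) : ℂ))
      (timeConv μ p f t)‖ₑ ^ 2) atTop ≤
        ENNReal.ofReal (C / √c) ^ 2 * ∫⁻ τ in Ioo 0 T, ‖f τ‖ₑ ^ 2 := by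
    refine liminf_le_of_le (by isBoundedDefault) fun b hb => ?_
    obtain ⟨N, hN⟩ := hb.exists
    exact hN.trans (hp.enorm_mulL2_timeConv_sq_le' (isWeight_cutoff_mul hw hw0 N)
      (cutoff_mul_le hw0 N) ht (hf.integrable one_le_two))
  have hfin : ENNReal.ofReal (C / √c) ^ 2 * ∫⁻ τ in Ioo 0 T, ‖f τ‖ₑ ^ 2 ≠ ∞ := by
    rw [← eLpNorm_two_sq]
    have := hf.2.ne
    finiteness
  obtain ⟨G, h1, h2, -⟩ := exists_eq_mul hw hw (isWeight_cutoff_mul hw hw0) (timeConv μ p f t)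
    (hle.trans_lt hfin.lt_top).ne
  exact ⟨G, h1, h2.trans hle⟩

/-- The time convolution gains one power of the weight uniformly in time. -/
theorem exists_continuousOn (hw : Measurable w) (hw0 : ∀ x, 0 ≤ w x) {f : ℝ → Lp ℂ 2 μ}
    {T : ℝ} (hf : MemLp f 2 (volume.restrict (Ioo 0 T))) :
    ∃ U : ℝ → Lp ℂ 2 μ, ContinuousOn U (Icc 0 T) ∧
      (∀ t ∈ Icc 0 T, U t =ᵐ[μ] fun x => w x * timeConv μ p f t x) ∧
      ∀ t ∈ Icc 0 T, ‖U t‖ₑ ≤ ENNReal.ofReal (C / √c) * eLpNorm f 2 (volume.restrict (Ioo 0 T)) := by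
  have hfi : IntegrableOn f (Ioo 0 T) := hf.integrable one_le_two
  have h1 : ∀ t, ∃ G : Lp ℂ 2 μ, t ∈ Icc 0 T → (G =ᵐ[μ] fun x => w x * timeConv μ p f t x) ∧
      ‖G‖ₑ ^ 2 ≤ ENNReal.ofReal (C / √c) ^ 2 * ∫⁻ τ in Ioo 0 T, ‖f τ‖ₑ ^ 2 := by
    intro t
    by_cases ht : t ∈ Icc 0 T
    · obtain ⟨G, hG⟩ := hp.exists_eq_mul_timeConv hw hw0 ht hf
      exact ⟨G, fun _ => hG⟩
    · exact ⟨0, fun h => absurd h ht⟩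
  choose U hU using h1
  refine ⟨U, ?_, fun t ht => (hU t ht).1, fun t ht => ?_⟩
  · let UN : ℕ → ℝ → Lp ℂ 2 μ := fun N t =>
      mulL2 μ (fun x => ((cutoff w N x * w x : ℝ) : ℂ)) (timeConv μ p f t)
    have hUN : ∀ N, ContinuousOn (UN N) (Icc 0 T) := fun N =>
      (mulL2 μ _).continuous.comp_continuousOn (hp.continuousOn_timeConv hfi)
    -- The truncation error $w(1-\chi_N)\int p f$ is the weighted convolution of $(1-\chi_N)f$, so
    -- the estimate just proved controls it uniformly in $t$.
    have hdiff : ∀ N, ∀ t ∈ Icc 0 T, edist (U t) (UN N t) ^ 2 ≤ ENNReal.ofReal (C / √c) ^ 2 *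
        ∫⁻ τ in Ioo 0 T, ‖mulL2 μ (fun x => (1 - cutoff w N x : ℂ)) (f τ)‖ₑ ^ 2 := by
      intro N t ht
      have hb : IsBddMeas fun x => (1 - cutoff w N x : ℂ) :=
        ⟨measurable_const.sub (isWeight_cutoff hw N).isBddMeas.1, 1, norm_one_sub_cutoff_le w N⟩
      obtain ⟨G, hG, hGle⟩ := hp.exists_eq_mul_timeConv hw hw0 ht
        (ContinuousLinearMap.comp_memLp' (mulL2 μ fun x => (1 - cutoff w N x : ℂ)) hf)
      have hcomm : timeConv μ p (mulL2 μ (fun x => (1 - cutoff w N x : ℂ)) ∘ f) t =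
          mulL2 μ (fun x => (1 - cutoff w N x : ℂ)) (timeConv μ p f t) := by
        rw [timeConv_eq ht.1, timeConv_eq ht.1,
          hp.mulL2_integral (hfi.mono_set (Ioo_subset_Ioo_right ht.2)) hb]
        rfl
      have heq : U t - UN N t = G := by
        refine Lp.ext ?_
        rw [hcomm] at hG
        filter_upwards [Lp.coeFn_sub (U t) (UN N t), (hU t ht).1, hG, coeFn_mulL2 hb
          (timeConv μ p f t), coeFn_mulL2 (isWeight_cutoff_mul hw hw0 N).isBddMeas
          (timeConv μ p f t)] with x h1 h2 h3 h4 h5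
        rw [h1, Pi.sub_apply, h2, h3, h4, h5]
        push_cast
        ring
      rw [edist_eq_enorm_sub, heq]
      exact hGle
    have hunif : TendstoUniformlyOn UN U atTop (Icc 0 T) := by
      rw [EMetric.tendstoUniformlyOn_iff]
      intro ε hε
      have h2 := ENNReal.Tendsto.const_mul (tendsto_lintegral_tail hw hf)
        (Or.inr (by finiteness : ENNReal.ofReal (C / √c) ^ 2 ≠ ∞))
      rw [mul_zero] at h2
      filter_upwards [h2.eventually_lt_const (by positivity : 0 < ε ^ 2)] with N hN t ht
      exact (ENNReal.pow_lt_pow_left_iff two_ne_zero).1 ((hdiff N t ht).trans_lt hN)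
    exact hunif.continuousOn (Frequently.of_forall hUN)
  · rw [← ENNReal.pow_le_pow_left_iff two_ne_zero, mul_pow, eLpNorm_two_sq]
    exact (hU t ht).2

/-- The time convolution gains two powers of the weight in the mean square in time. -/
theorem exists_memLp (hw : Measurable w) (hw0 : ∀ x, 0 ≤ w x) {f : ℝ → Lp ℂ 2 μ}
    {T : ℝ} (hf : MemLp f 2 (volume.restrict (Ioo 0 T))) :
    ∃ V : ℝ → Lp ℂ 2 μ, MemLp V 2 (volume.restrict (Ioo 0 T)) ∧
      (∀ᵐ t ∂volume.restrict (Ioo 0 T), V t =ᵐ[μ] fun x => ((w x * w x : ℝ) : ℂ) *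
        timeConv μ p f t x) ∧
      eLpNorm V 2 (volume.restrict (Ioo 0 T)) ≤
        ENNReal.ofReal (C / c) * eLpNorm f 2 (volume.restrict (Ioo 0 T)) := by
  have hfi : IntegrableOn f (Ioo 0 T) := hf.integrable one_le_two
  set ν := volume.restrict (Ioo 0 T) with hν
  -- The cutoff is idempotent, so the square of the truncated weight is the truncated square.
  have hcut : ∀ N x, cutoff w N x * w x * (cutoff w N x * w x) = cutoff w N x * (w x * w x) := by
    intro N x
    rw [mul_mul_mul_comm, cutoff_mul_self]
  have hW : ∀ N, IsWeight fun x => cutoff w N x * (w x * w x) := fun N => by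
    simpa only [hcut] using (isWeight_cutoff_mul hw hw0 N).mul (isWeight_cutoff_mul hw hw0 N)
  let VN : ℕ → ℝ → Lp ℂ 2 μ := fun N t =>
    mulL2 μ (fun x => ((cutoff w N x * (w x * w x) : ℝ) : ℂ)) (timeConv μ p f t)
  have hVN : ∀ N, AEStronglyMeasurable (VN N) ν := fun N =>
    ((mulL2 μ _).continuous.comp_continuousOn ((hp.continuousOn_timeConv hfi).mono
      Ioo_subset_Icc_self)).aestronglyMeasurable measurableSet_Ioo
  have hint : ∫⁻ t, liminf (fun N => ‖VN N t‖ₑ ^ 2) atTop ∂ν ≤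
      ENNReal.ofReal (C / c) ^ 2 * ∫⁻ τ, ‖f τ‖ₑ ^ 2 ∂ν := by
    refine (lintegral_liminf_le' fun N => (hVN N).enorm.pow_const 2).trans ?_
    refine liminf_le_of_le (by isBoundedDefault) fun b hb => ?_
    obtain ⟨N, hN⟩ := hb.exists
    refine hN.trans ?_
    have := hp.lintegral_mulL2_sq_timeConv_sq_le (isWeight_cutoff_mul hw hw0 N)
      (cutoff_mul_le hw0 N) hfi
    simpa only [hcut] using this
  have hfin : ENNReal.ofReal (C / c) ^ 2 * ∫⁻ τ, ‖f τ‖ₑ ^ 2 ∂ν ≠ ∞ := by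
    rw [← eLpNorm_two_sq]
    have := hf.2.ne
    finiteness
  -- By Fatou in time the liminf is integrable, hence finite for almost every $t$. Only at those
  -- times is $w^2$ times the convolution claimed to be in $L^2$; elsewhere `V` is set to `0`.
  have hae : ∀ᵐ t ∂ν, liminf (fun N => ‖VN N t‖ₑ ^ 2) atTop < ∞ := by
    refine ae_lt_top' ?_ (hint.trans_lt hfin.lt_top).ne
    simp only [liminf_eq_iSup_iInf_of_nat']
    exact AEMeasurable.iSup fun n => AEMeasurable.iInf fun i => (hVN (i + n)).enorm.pow_const 2
  have h1 : ∀ t, ∃ G : Lp ℂ 2 μ, liminf (fun N => ‖VN N t‖ₑ ^ 2) atTop < ∞ →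
      (G =ᵐ[μ] fun x => ((w x * w x : ℝ) : ℂ) * timeConv μ p f t x) ∧
      ‖G‖ₑ ^ 2 ≤ liminf (fun N => ‖VN N t‖ₑ ^ 2) atTop ∧
      Tendsto (fun N => VN N t) atTop (𝓝 G) := by
    intro t
    by_cases ht : liminf (fun N => ‖VN N t‖ₑ ^ 2) atTop < ∞
    · obtain ⟨G, hG⟩ := exists_eq_mul hw (hw.mul hw) hW (timeConv μ p f t) ht.ne
      exact ⟨G, fun _ => hG⟩
    · exact ⟨0, fun h => absurd h ht⟩
  choose V hV using h1
  -- `V` is chosen pointwise; its measurability comes from being an a.e. limit of the truncations.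
  have hVm : AEStronglyMeasurable V ν := by
    refine aestronglyMeasurable_of_tendsto_ae atTop hVN ?_
    filter_upwards [hae] with t ht using (hV t ht).2.2
  have hle : eLpNorm V 2 ν ≤ ENNReal.ofReal (C / c) * eLpNorm f 2 ν := by
    rw [← ENNReal.pow_le_pow_left_iff two_ne_zero, mul_pow, eLpNorm_two_sq, eLpNorm_two_sq]
    refine le_trans (lintegral_mono_ae ?_) hint
    filter_upwards [hae] with t ht using (hV t ht).2.1
  refine ⟨V, ⟨hVm, hle.trans_lt ?_⟩, ?_, hle⟩
  · have := hf.2.ne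
    finiteness
  · filter_upwards [hae] with t ht using (hV t ht).1

end IsDecaying

end Weighted

/-! ### Sobolev spaces on the Fourier side. -/

section SobolevFourier

variable {n : ℕ}

/-- The Fourier symbol of `∂_j`, as a function of `η = ξ / 2π`. -/
def derivSymbol (j : Fin n) (η : Space n) : ℂ := Complex.I * (((2 * Real.pi) • η) j : ℝ)

theorem continuous_derivSymbol (j : Fin n) : Continuous (derivSymbol j) := by
  unfold derivSymbol; fun_prop

theorem fourier_lineDerivOp_apply (f : L2 n) (j : Fin n) (u : 𝓢(Space n, ℂ)) :
    (𝓕 (∂_{basisVec j} (f : 𝓢'(Space n, ℂ))) : 𝓢'(Space n, ℂ)) u =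
      ∫ η, u η * (derivSymbol j η * (𝓕 f : L2 n) η) := by
  have hg : (fun η : Space n => (inner ℝ η (basisVec j) : ℂ)).HasTemperateGrowth := by fun_prop
  rw [TemperedDistribution.fourier_lineDerivOp_eq, Lp.fourier_toTemperedDistribution_eq]
  simp only [smul_apply, TemperedDistribution.smulLeftCLM_apply_apply,
    Lp.toTemperedDistribution_apply, smul_eq_mul]
  rw [← integral_const_mul]
  congr 1 with η
  rw [SchwartzMap.smulLeftCLM_apply_apply hg]
  simp [derivSymbol, basisVec, EuclideanSpace.inner_single_right]
  ring

/-- Injectivity of the Fourier transform on tempered distributions. -/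
theorem eq_lineDerivOp_of_fourier {f g : L2 n} {j : Fin n}
    (h : (𝓕 g : L2 n) =ᵐ[volume] fun η => derivSymbol j η * (𝓕 f : L2 n) η) :
    (g : 𝓢'(Space n, ℂ)) = ∂_{basisVec j} (f : 𝓢'(Space n, ℂ)) := by
  have h1 : 𝓕 (g : 𝓢'(Space n, ℂ)) = 𝓕 (∂_{basisVec j} (f : 𝓢'(Space n, ℂ))) := by
    ext u
    rw [fourier_lineDerivOp_apply, Lp.fourier_toTemperedDistribution_eq,
      Lp.toTemperedDistribution_apply]
    refine integral_congr_ae ?_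
    filter_upwards [h] with η hη
    rw [hη, smul_eq_mul]
  have h2 := congrArg (𝓕⁻ · : 𝓢'(Space n, ℂ) → 𝓢'(Space n, ℂ)) h1
  simpa only [fourierInv_fourier_eq] using h2

/-- The product on the right is only locally integrable a priori, so the two sides are compared by
testing against smooth functions of compact support. -/
theorem fourier_of_eq_lineDerivOp {f g : L2 n} {j : Fin n}
    (h : (g : 𝓢'(Space n, ℂ)) = ∂_{basisVec j} (f : 𝓢'(Space n, ℂ))) :
    (𝓕 g : L2 n) =ᵐ[volume] fun η => derivSymbol j η * (𝓕 f : L2 n) η := by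
  have h1 : 𝓕 (g : 𝓢'(Space n, ℂ)) = 𝓕 (∂_{basisVec j} (f : 𝓢'(Space n, ℂ))) := by rw [h]
  have hloc : ∀ k : L2 n, LocallyIntegrable k volume := fun k =>
    (Lp.memLp k).locallyIntegrable one_le_two
  refine ae_eq_of_integral_contDiff_smul_eq (hloc _) ?_ fun φ hφ hc => ?_
  · rw [locallyIntegrable_iff]
    exact fun K hK => ((hloc (𝓕 f)).integrableOn_isCompact hK).continuousOn_mul
      (continuous_derivSymbol j).continuousOn hK
  · have hg₁ : HasCompactSupport (Complex.ofRealCLM ∘ φ) := hc.comp_left rfl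
    have hg₂ : ContDiff ℝ ((⊤ : ℕ∞) : WithTop ℕ∞) (Complex.ofRealCLM ∘ φ) := by fun_prop
    have h2 := DFunLike.congr_fun h1 (hg₁.toSchwartzMap hg₂)
    rw [fourier_lineDerivOp_apply, Lp.fourier_toTemperedDistribution_eq,
      Lp.toTemperedDistribution_apply] at h2
    simpa using h2

/-- The Fourier symbol of `∂^α`, as a function of `η = ξ / 2π`. -/
def monomialSymbol (α : Fin n → ℕ) (η : Space n) : ℂ := ∏ j, derivSymbol j η ^ α j

theorem monomialSymbol_add_single (α : Fin n → ℕ) (j : Fin n) (η : Space n) :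
    monomialSymbol (α + Pi.single j 1) η = derivSymbol j η * monomialSymbol α η := by
  simp only [monomialSymbol, Pi.add_apply, pow_add, Finset.prod_mul_distrib]
  rw [mul_comm]
  congr 1
  rw [Finset.prod_eq_single j]
  · simp
  · intro i _ hi
    simp [Pi.single_eq_of_ne hi]
  · simp

theorem monomialSymbol_single (j : Fin n) (k : ℕ) (η : Space n) :
    monomialSymbol (Pi.single j k) η = derivSymbol j η ^ k := by
  rw [monomialSymbol, Finset.prod_eq_single j]
  · simp
  · intro i _ hi
    simp [Pi.single_eq_of_ne hi]
  · simp

theorem continuous_monomialSymbol (α : Fin n → ℕ) : Continuous (monomialSymbol α) :=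
  continuous_finsetProd _ fun j _ => (continuous_derivSymbol j).pow _

/-- The modulus `|ξ|`, as a function of `η = ξ / 2π`. -/
def freq (η : Space n) : ℝ := ‖(2 * Real.pi) • η‖

theorem freq_nonneg (η : Space n) : 0 ≤ freq η := norm_nonneg _

theorem continuous_freq : Continuous (freq (n := n)) := by unfold freq; fun_prop

theorem norm_derivSymbol (j : Fin n) (η : Space n) :
    ‖derivSymbol j η‖ = |((2 * Real.pi) • η) j| := by
  simp [derivSymbol]

theorem norm_derivSymbol_le (j : Fin n) (η : Space n) : ‖derivSymbol j η‖ ≤ freq η :=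
  (norm_derivSymbol j η).trans_le (abs_coord_le _ j)

theorem norm_monomialSymbol_le (α : Fin n → ℕ) (η : Space n) :
    ‖monomialSymbol α η‖ ≤ freq η ^ ∑ j, α j := by
  rw [monomialSymbol, norm_prod, ← Finset.prod_pow_eq_pow_sum]
  refine Finset.prod_le_prod (fun _ _ => norm_nonneg _) fun j _ => ?_
  rw [norm_pow]
  exact pow_le_pow_left₀ (norm_nonneg _) (norm_derivSymbol_le j η) _

/-- On the Fourier side, the member of index `α` of an element of `H^k` is `(iξ)^α û`. -/
theorem fourier_sobolev {k : ℕ} {u : Jet n k} (hu : u ∈ sobolev n k) (α : multiIndices n k) :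
    (𝓕 (u α) : L2 n) =ᵐ[volume] fun η =>
      monomialSymbol α.1 η * (𝓕 (u (zeroIndex n k)) : L2 n) η := by
  obtain ⟨m, hm⟩ : ∃ m, ∑ j, α.1 j = m := ⟨_, rfl⟩
  induction m generalizing α with
  | zero =>
    have h0 : α = zeroIndex n k := by
      refine Subtype.ext (funext fun j => ?_)
      simpa [zeroIndex] using (Finset.sum_eq_zero_iff.1 hm) j (Finset.mem_univ j)
    rw [h0]
    filter_upwards with η
    simp [monomialSymbol, zeroIndex]
  | succ m ih =>
    obtain ⟨j, hj⟩ : ∃ j, α.1 j ≠ 0 := by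
      by_contra! h
      simp [h] at hm
    -- The truncated subtraction is exact because $\alpha_j\ge1$.
    have hadd : α.1 = (α.1 - Pi.single j 1) + Pi.single j 1 := by
      refine (tsub_add_cancel_of_le fun i => ?_).symm
      rcases eq_or_ne i j with rfl | hi
      · simpa using Nat.one_le_iff_ne_zero.2 hj
      · simp [Pi.single_eq_of_ne hi]
    have hsum : ∑ i, (α.1 - Pi.single j 1 : Fin n → ℕ) i = m := by
      have h1 := congrArg (fun β : Fin n → ℕ => ∑ i, β i) hadd
      simp only [Pi.add_apply, Finset.sum_add_distrib, hm] at h1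
      simpa using h1.symm
    have hmem : α.1 - Pi.single j 1 ∈ multiIndices n k := by
      have := mem_multiIndices.1 α.2
      rw [mem_multiIndices, hsum]
      omega
    have h2 := fourier_of_eq_lineDerivOp (hu ⟨_, hmem⟩ α j hadd)
    filter_upwards [h2, ih ⟨_, hmem⟩ hsum] with η h3 h4
    rw [h3, h4, hadd, monomialSymbol_add_single, mul_assoc]
    simp

/-- The multiplier `(iξ)^α |ξ|^{-k}`, cut off to `|ξ| ≥ r`. -/
def liftSymbol (r : ℝ) (k : ℕ) (α : Fin n → ℕ) (η : Space n) : ℂ :=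
  {η : Space n | r ≤ freq η}.indicator (fun η => monomialSymbol α η * ((freq η ^ k)⁻¹ : ℝ)) η

theorem measurableSet_highFreq (r : ℝ) : MeasurableSet {η : Space n | r ≤ freq η} :=
  measurableSet_le measurable_const continuous_freq.measurable

/-- $|\xi^\alpha||\xi|^{-k}\le|\xi|^{|\alpha|-k}\le r^{|\alpha|-k}$ on $|\xi|\ge r$. The absence of
low frequencies is essential here. -/
theorem isBddMeas_liftSymbol {r : ℝ} (hr : 0 < r) {k : ℕ} {α : Fin n → ℕ} (hα : ∑ j, α j ≤ k) :
    IsBddMeas (liftSymbol r k α) := by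
  refine ⟨?_, (r ^ (k - ∑ j, α j))⁻¹, fun η => ?_⟩
  · have h1 := (continuous_monomialSymbol α).measurable
    have h2 := (continuous_freq (n := n)).measurable
    exact Measurable.indicator (by fun_prop) (measurableSet_highFreq r)
  · by_cases h : r ≤ freq η
    · have hf : 0 < freq η := hr.trans_le h
      rw [liftSymbol, Set.indicator_of_mem (by exact h), norm_mul, Complex.norm_real,
        Real.norm_of_nonneg (by positivity)]
      calc _ ≤ freq η ^ (∑ j, α j) * (freq η ^ k)⁻¹ := by
            gcongr; exact norm_monomialSymbol_le α η
        _ = (freq η ^ (k - ∑ j, α j))⁻¹ := by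
            conv_lhs => rw [← Nat.add_sub_of_le hα, pow_add]
            field_simp
        _ ≤ _ := by gcongr
    · rw [liftSymbol, Set.indicator_of_notMem (by exact h), norm_zero]
      positivity

/-- The family `(∂^α 𝓕⁻¹(χ_{|ξ| ≥ r} |ξ|^{-k} g))_α`. -/
def liftJet (n : ℕ) (r : ℝ) (k : ℕ) : L2 n →L[ℂ] Jet n k :=
  (PiLp.continuousLinearEquiv 2 ℂ fun _ : multiIndices n k => L2 n).symm.toContinuousLinearMap ∘L
    ContinuousLinearMap.pi fun α => fourierInvCLM ℂ (L2 n) ∘L mulL2 volume (liftSymbol r k α.1)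

theorem liftJet_apply (r : ℝ) (k : ℕ) (g : L2 n) (α : multiIndices n k) :
    liftJet n r k g α = 𝓕⁻ (mulL2 volume (liftSymbol r k α.1) g) := rfl

theorem fourier_liftJet {r : ℝ} (hr : 0 < r) (k : ℕ) (g : L2 n) (α : multiIndices n k) :
    (𝓕 (liftJet n r k g α) : L2 n) =ᵐ[volume] fun η => liftSymbol r k α.1 η * g η := by
  rw [liftJet_apply, fourier_fourierInv_eq]
  exact coeFn_mulL2 (isBddMeas_liftSymbol hr (mem_multiIndices.1 α.2)) g

theorem liftJet_mem {r : ℝ} (hr : 0 < r) (k : ℕ) (g : L2 n) :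
    liftJet n r k g ∈ highSobolev n r k := by
  refine ⟨fun α β j h => ?_, ?_⟩
  · refine eq_lineDerivOp_of_fourier ?_
    filter_upwards [fourier_liftJet hr k g α, fourier_liftJet hr k g β] with η h1 h2
    rw [h1, h2, h]
    by_cases hη : r ≤ freq η
    · simp only [liftSymbol, Set.indicator_of_mem (show η ∈ {η : Space n | r ≤ freq η} from hη),
        monomialSymbol_add_single]
      ring
    · simp only [liftSymbol,
        Set.indicator_of_notMem (show η ∉ {η : Space n | r ≤ freq η} from hη)]
      ring
  · filter_upwards [fourier_liftJet hr k g (zeroIndex n k)] with η h1 h2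
    rw [h1, liftSymbol, Set.indicator_of_notMem (by simpa [freq] using h2), zero_mul]

/-- The function of `H^k_{(∞)}` with Fourier transform `χ_{|ξ| ≥ r} |ξ|^{-k} g`. -/
def liftHigh (n : ℕ) {r : ℝ} (hr : 0 < r) (k : ℕ) : L2 n →L[ℂ] highSobolev n r k :=
  (liftJet n r k).codRestrict _ (liftJet_mem hr k)

/-- The multi-index `k e_j`. -/
def powIndex (n k : ℕ) (j : Fin n) : multiIndices n k :=
  ⟨Pi.single j k, by simp [mem_multiIndices]⟩

/-- `∑_l |ξ_l|^{2k}`. -/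
def coordPowSum (k : ℕ) (η : Space n) : ℝ := ∑ l, ‖derivSymbol l η‖ ^ (2 * k)

/-- The largest coordinate satisfies $|\xi|^2\le n|\xi_l|^2$. Thus the pure derivatives of order $k$
suffice to control $|\xi|^k\hat u$. -/
theorem freq_pow_le (k : ℕ) (hn : 0 < n) (η : Space n) :
    freq η ^ (2 * k) ≤ n ^ k * coordPowSum k η := by
  have : NeZero n := ⟨hn.ne'⟩
  obtain ⟨l, -, hl⟩ := Finset.exists_max_image Finset.univ (fun l => ‖derivSymbol l η‖)
    Finset.univ_nonempty
  have h1 : freq η ^ 2 ≤ n * ‖derivSymbol l η‖ ^ 2 := by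
    rw [freq, EuclideanSpace.norm_sq_eq]
    calc _ ≤ ∑ _i : Fin n, ‖derivSymbol l η‖ ^ 2 := by
          refine Finset.sum_le_sum fun i hi => ?_
          rw [Real.norm_eq_abs, ← norm_derivSymbol]
          exact pow_le_pow_left₀ (norm_nonneg _) (hl i hi) 2
      _ = _ := by simp
  calc freq η ^ (2 * k) = (freq η ^ 2) ^ k := pow_mul _ _ _
    _ ≤ (n * ‖derivSymbol l η‖ ^ 2) ^ k := by gcongr
    _ = n ^ k * ‖derivSymbol l η‖ ^ (2 * k) := by rw [mul_pow, pow_mul]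
    _ ≤ _ := by
      refine mul_le_mul_of_nonneg_left ?_ (by positivity)
      exact Finset.single_le_sum (f := fun l => ‖derivSymbol l η‖ ^ (2 * k))
        (fun _ _ => by positivity) (Finset.mem_univ l)

/-- Multipliers `q_j` with `∑_j q_j (iξ_j)^k = |ξ|^k`. -/
def powSymbol (k : ℕ) (j : Fin n) (η : Space n) : ℂ :=
  starRingEnd ℂ (derivSymbol j η ^ k) * ((freq η ^ k / coordPowSum k η : ℝ) : ℂ)

theorem isBddMeas_powSymbol (hn : 0 < n) (k : ℕ) (j : Fin n) : IsBddMeas (powSymbol k j) := by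
  have hS : ∀ η : Space n, 0 ≤ coordPowSum k η := fun η =>
    Finset.sum_nonneg fun _ _ => by positivity
  refine ⟨?_, n ^ k, fun η => ?_⟩
  · have h1 := continuous_freq (n := n)
    have h2 : Continuous (coordPowSum (n := n) k) :=
      continuous_finsetSum _ fun l _ => (continuous_derivSymbol l).norm.pow _
    have h3 := (Complex.continuous_conj.comp ((continuous_derivSymbol j).pow k)).measurable
    refine h3.mul (Complex.measurable_ofReal.comp ?_)
    exact (h1.measurable.pow_const k).div h2.measurable
  · rw [powSymbol, norm_mul, RCLike.norm_conj, norm_pow, Complex.norm_real,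
      Real.norm_of_nonneg (div_nonneg (pow_nonneg (freq_nonneg η) _) (hS η)), ← mul_div_assoc]
    refine div_le_of_le_mul₀ (hS η) (by positivity) ?_
    refine le_trans ?_ (freq_pow_le k hn η)
    rw [two_mul, pow_add]
    have := freq_nonneg η
    gcongr
    exact norm_derivSymbol_le j η

theorem sum_powSymbol (hn : 0 < n) (k : ℕ) (η : Space n) :
    ∑ j, powSymbol k j η * derivSymbol j η ^ k = (freq η ^ k : ℝ) := by
  have h1 : ∀ j, powSymbol k j η * derivSymbol j η ^ k =
      ((‖derivSymbol j η‖ ^ (2 * k) * (freq η ^ k / coordPowSum k η) : ℝ) : ℂ) := by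
    intro j
    have h2 : starRingEnd ℂ (derivSymbol j η ^ k) * derivSymbol j η ^ k =
        ((‖derivSymbol j η‖ ^ (2 * k) : ℝ) : ℂ) := by
      rw [Complex.conj_mul', norm_pow]
      push_cast
      ring
    rw [powSymbol, mul_right_comm, h2]
    push_cast
    ring
  simp only [h1]
  rw [← Complex.ofReal_sum, ← Finset.sum_mul]
  congr 1
  change coordPowSum k η * _ = _
  -- If the denominator vanishes then so does $|\xi|^k$, in agreement with the convention for
  -- division by zero.
  rcases eq_or_ne (coordPowSum k η) 0 with h0 | h0
  · have h3 := freq_pow_le k hn η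
    rw [h0, mul_zero, mul_comm 2 k, pow_mul] at h3
    have h4 : freq η ^ k = 0 := by
      have := sq_nonneg (freq η ^ k)
      exact pow_eq_zero_iff two_ne_zero |>.1 (le_antisymm h3 this)
    rw [h0, h4, zero_mul]
  · field_simp

/-- The operator `u ↦ |ξ|^k û` on `H^k_{(∞)}`. -/
def lowerHigh (n : ℕ) (r : ℝ) (k : ℕ) : highSobolev n r k →L[ℂ] L2 n :=
  ∑ j, mulL2 volume (powSymbol k j) ∘L fourierCLM ℂ (L2 n) ∘L
    PiLp.proj 2 (fun _ : multiIndices n k => L2 n) (powIndex n k j) ∘L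
      (highSobolev n r k).subtypeL

theorem coeFn_finsetSum {X ι : Type*} [MeasurableSpace X] {μ : Measure X} (s : Finset ι)
    (f : ι → Lp ℂ 2 μ) : ((∑ i ∈ s, f i : Lp ℂ 2 μ) : X → ℂ) =ᵐ[μ] fun x => ∑ i ∈ s, f i x := by
  classical
  induction s using Finset.induction_on with
  | empty =>
    filter_upwards [Lp.coeFn_zero ℂ 2 μ] with x hx
    rw [Finset.sum_empty, Finset.sum_empty]
    exact hx
  | insert i s hi ih =>
    rw [Finset.sum_insert hi]
    filter_upwards [Lp.coeFn_add (f i) (∑ i ∈ s, f i), ih] with x h1 h2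
    rw [h1, Pi.add_apply, h2, Finset.sum_insert hi]

/-- `lowerHigh` is continuous by construction, as a sum of bounded multipliers applied to the pure
$k$-th derivatives. The identity $\sum_jq_j(i\xi_j)^k=|\xi|^k$ identifies the sum. -/
theorem coeFn_lowerHigh (hn : 0 < n) {r : ℝ} {k : ℕ} (u : highSobolev n r k) :
    (lowerHigh n r k u : Space n → ℂ) =ᵐ[volume] fun η =>
      (freq η ^ k : ℝ) * (𝓕 (u.1 (zeroIndex n k)) : L2 n) η := by
  have h0 : lowerHigh n r k u =
      ∑ j, mulL2 volume (powSymbol k j) (𝓕 (u.1 (powIndex n k j)) : L2 n) := by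
    simp only [lowerHigh, sum_apply]
    rfl
  rw [h0]
  have h1 : ∀ᵐ η : Space n, ∀ j, (mulL2 volume (powSymbol k j) (𝓕 (u.1 (powIndex n k j)) : L2 n) :
      Space n → ℂ) η =
        powSymbol k j η * (derivSymbol j η ^ k * (𝓕 (u.1 (zeroIndex n k)) : L2 n) η) := by
    refine ae_all_iff.2 fun j => ?_
    filter_upwards [coeFn_mulL2 (isBddMeas_powSymbol hn k j) (𝓕 (u.1 (powIndex n k j)) : L2 n),
      fourier_sobolev u.2.1 (powIndex n k j)] with η h2 h3
    rw [h2, h3]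
    simp [powIndex, monomialSymbol_single]
  filter_upwards [coeFn_finsetSum Finset.univ fun j =>
    mulL2 volume (powSymbol k j) (𝓕 (u.1 (powIndex n k j)) : L2 n), h1] with η h2 h3
  rw [h2, ← sum_powSymbol hn, Finset.sum_mul]
  refine Finset.sum_congr rfl fun j _ => ?_
  rw [h3, mul_assoc]

theorem fourier_eq_zero_of_lt {r : ℝ} {k : ℕ} (u : highSobolev n r k) :
    ∀ᵐ η : Space n, freq η < r → (𝓕 (u.1 (zeroIndex n k)) : L2 n) η = 0 := u.2.2

end SobolevFourier

/-! ### Parabolic decay of the rescaled symbol. -/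

section SymbolDecay

variable {n : ℕ}

/-- The entries of the symbol of `S(t)`, `t ≥ 0`, in the variables `(|ξ| φ̂, m̂)`, as functions of
`η = ξ / 2π`. The index `none` stands for the density, `some i` for the `i`-th momentum. -/
def entry (ν ν' κ : ℝ) : Option (Fin n) → Option (Fin n) → ℝ → Space n → ℂ
  | none, none => fun t η => symbol11 n ν ν' κ (max t 0) ((2 * Real.pi) • η)
  | none, some j => fun t η => (freq η : ℂ) * symbol12 n ν ν' κ (max t 0) ((2 * Real.pi) • η) j
  | some i, none => fun t η =>
      ((freq η)⁻¹ : ℝ) * symbol21 n ν ν' κ (max t 0) ((2 * Real.pi) • η) i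
  | some i, some j => fun t η => symbol22 n ν ν' κ (max t 0) ((2 * Real.pi) • η) i j

theorem continuous_kernelOne (a b : ℂ) : Continuous fun t : ℝ => kernelOne a b t := by
  unfold kernelOne
  split_ifs <;> fun_prop

theorem continuous_entry (ν ν' κ : ℝ) (k l : Option (Fin n)) (η : Space n) :
    Continuous fun t => entry ν ν' κ k l t η := by
  have h1 := fun a b => (continuous_kernelOne a b).comp (continuous_id.max continuous_const :
    Continuous fun t : ℝ => max t 0)
  simp only [Function.comp_def] at h1
  rcases k with _ | i <;> rcases l with _ | j
  · simp only [entry, symbol11, kernelZero_eq]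
    have := h1 (lamPlus ν ν' κ (‖(2 * Real.pi) • η‖ ^ 2)) (lamMinus ν ν' κ (‖(2 * Real.pi) • η‖ ^ 2))
    fun_prop
  · simp only [entry, symbol12]
    have := h1 (lamPlus ν ν' κ (‖(2 * Real.pi) • η‖ ^ 2)) (lamMinus ν ν' κ (‖(2 * Real.pi) • η‖ ^ 2))
    fun_prop
  · simp only [entry, symbol21]
    have := h1 (lamPlus ν ν' κ (‖(2 * Real.pi) • η‖ ^ 2)) (lamMinus ν ν' κ (‖(2 * Real.pi) • η‖ ^ 2))
    fun_prop
  · simp only [entry, symbol22, kernelTwo_eq]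
    have := h1 (lamPlus ν ν' κ (‖(2 * Real.pi) • η‖ ^ 2)) (lamMinus ν ν' κ (‖(2 * Real.pi) • η‖ ^ 2))
    fun_prop

theorem measurable_lamPlus (ν ν' κ : ℝ) :
    Measurable fun ξ : Space n => lamPlus ν ν' κ (‖ξ‖ ^ 2) := by
  unfold lamPlus; fun_prop

theorem measurable_lamMinus (ν ν' κ : ℝ) :
    Measurable fun ξ : Space n => lamMinus ν ν' κ (‖ξ‖ ^ 2) := by
  unfold lamMinus; fun_prop

theorem measurable_entry (ν ν' κ : ℝ) (k l : Option (Fin n)) (t : ℝ) :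
    Measurable (entry ν ν' κ k l t) := by
  have h1 := measurable_kernelOne (n := n) ν ν' κ (max t 0)
  have h2 := measurable_lamPlus (n := n) ν ν' κ
  have h3 := measurable_lamMinus (n := n) ν ν' κ
  have h4 : Measurable fun η : Space n => (2 * Real.pi) • η := measurable_const_smul _
  have h5 := (continuous_freq (n := n)).measurable
  rcases k with _ | i <;> rcases l with _ | j
  · have : Measurable (symbol11 n ν ν' κ (max t 0)) := by
      unfold symbol11
      simp only [kernelZero_eq]
      fun_prop
    exact this.comp h4
  · have : Measurable fun ξ => symbol12 n ν ν' κ (max t 0) ξ j := by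
      unfold symbol12
      fun_prop
    exact (Complex.measurable_ofReal.comp h5).mul (this.comp h4)
  · have : Measurable fun ξ => symbol21 n ν ν' κ (max t 0) ξ i := by
      unfold symbol21
      fun_prop
    exact (Complex.measurable_ofReal.comp h5.inv).mul (this.comp h4)
  · have : Measurable fun ξ => symbol22 n ν ν' κ (max t 0) ξ i j := by
      unfold symbol22
      simp only [kernelTwo_eq]
      fun_prop
    exact this.comp h4

/-- Half of the exponential absorbs the factor $xt$, because $y\le e^y$ for $y=cxt/2$. -/
theorem mul_exp_neg_le {c : ℝ} (hc : 0 < c) (x t : ℝ) :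
    x * (t * Real.exp (-(c * x) * t)) ≤ 2 / c * Real.exp (-(c / 2 * x * t)) := by
  have h1 : Real.exp (-(c * x) * t) =
      Real.exp (-(c / 2 * x * t)) * (Real.exp (c / 2 * x * t))⁻¹ := by
    rw [← Real.exp_neg, ← Real.exp_add]
    congr 1
    ring
  have h2 : c / 2 * x * t ≤ Real.exp (c / 2 * x * t) := by
    linarith [Real.add_one_le_exp (c / 2 * x * t)]
  have h3 : x * t * (Real.exp (c / 2 * x * t))⁻¹ ≤ 2 / c := by
    rw [← div_eq_mul_inv, div_le_div_iff₀ (Real.exp_pos _) hc]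
    linarith
  calc _ = x * t * (Real.exp (c / 2 * x * t))⁻¹ * Real.exp (-(c / 2 * x * t)) := by
        rw [h1]; ring
    _ ≤ _ := by gcongr

/-- All entries of the rescaled symbol decay like `e^{-c |ξ|² t}`. -/
theorem exists_isDecaying_entry {ν ν' κ : ℝ} (hν : 0 < ν) (hνν' : 0 < ν + ν') (hκ : 0 < κ) :
    ∃ C c : ℝ, ∀ k l : Option (Fin n), IsDecaying freq C c (entry (n := n) ν ν' κ k l) := by
  obtain ⟨c₀, M, hc₀, hM, hb⟩ := exists_lam_bounds hνν' hκ
  -- Half of the rate $c_0$ is lost in `mul_exp_neg_le`; $\nu$ is the rate of the divergence-free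
  -- part of the momentum.
  set c := min (c₀ / 2) ν with hc
  have hcpos : 0 < c := lt_min (by positivity) hν
  set B := 2 / c₀ with hB
  have hBpos : 0 < B := by positivity
  -- The summand $3$ counts the three exponentials in $S_{22}$, $MB$ bounds $\lambda_-$ times the
  -- kernel in $S_{11}$ and $S_{22}$, and $B$ and $\kappa B$ bound the off-diagonal entries.
  refine ⟨3 + M * B + B + κ * B, c, fun k l => ⟨hcpos, by positivity,
    measurable_entry ν ν' κ k l, continuous_entry ν ν' κ k l, fun t η => ?_⟩⟩
  have ht : 0 ≤ max t 0 := le_max_right _ _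
  generalize hs : max t 0 = s at ht
  set ξ := (2 * Real.pi) • η with hξ
  have hfreq : freq η = ‖ξ‖ := rfl
  have hx : 0 ≤ ‖ξ‖ ^ 2 := by positivity
  obtain ⟨h1, h2, h3⟩ := hb (‖ξ‖ ^ 2) hx
  set E := Real.exp (-(c * ‖ξ‖ ^ 2 * s)) with hE
  have hE0 : 0 < E := Real.exp_pos _
  have hmono : ∀ d, c ≤ d → Real.exp (-(d * ‖ξ‖ ^ 2 * s)) ≤ E := by
    intro d hd
    refine Real.exp_le_exp.2 (neg_le_neg ?_)
    gcongr
  have hcc : c ≤ c₀ / 2 := min_le_left _ _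
  have hexp : ∀ z : ℂ, z.re ≤ -(c₀ * ‖ξ‖ ^ 2) → ‖Complex.exp (z * s)‖ ≤ E := by
    intro z hz
    rw [Complex.norm_exp, Complex.re_mul_ofReal]
    refine (Real.exp_le_exp.2 (mul_le_mul_of_nonneg_right hz ht)).trans ?_
    have := hmono c₀ (by linarith)
    rwa [← neg_mul] at this
  set K := kernelOne (lamPlus ν ν' κ (‖ξ‖ ^ 2)) (lamMinus ν ν' κ (‖ξ‖ ^ 2)) s with hK
  have hKx : ‖ξ‖ ^ 2 * ‖K‖ ≤ B * E :=
    calc ‖ξ‖ ^ 2 * ‖K‖ ≤ ‖ξ‖ ^ 2 * (s * Real.exp (-(c₀ * ‖ξ‖ ^ 2) * s)) := by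
          gcongr; exact norm_kernelOne_le ht h1 h2
      _ ≤ B * Real.exp (-(c₀ / 2 * ‖ξ‖ ^ 2 * s)) := mul_exp_neg_le hc₀ _ _
      _ ≤ B * E := by gcongr; exact hmono _ hcc
  have hlamK : ‖lamMinus ν ν' κ (‖ξ‖ ^ 2) * K‖ ≤ M * B * E := by
    rw [norm_mul]
    calc _ ≤ M * ‖ξ‖ ^ 2 * ‖K‖ := by gcongr
      _ = M * (‖ξ‖ ^ 2 * ‖K‖) := by ring
      _ ≤ M * (B * E) := by gcongr
      _ = _ := by ring
  have hsplit : (3 + M * B + B + κ * B) * E = 3 * E + M * B * E + B * E + κ * (B * E) := by ring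
  have p1 : 0 ≤ M * B * E := by positivity
  have p2 : 0 ≤ B * E := by positivity
  have p3 : 0 ≤ κ * (B * E) := by positivity
  rw [hfreq, ← hE, hsplit]
  have hcoord : ∀ i, ‖((ξ i : ℝ) : ℂ)‖ ≤ ‖ξ‖ := fun i => by
    rw [Complex.norm_real]; exact abs_coord_le ξ i
  rcases k with _ | i <;> rcases l with _ | j
  · simp only [entry, hs, ← hξ, symbol11, kernelZero_eq, ← hK]
    have := norm_sub_le (Complex.exp (lamMinus ν ν' κ (‖ξ‖ ^ 2) * s))
      (lamMinus ν ν' κ (‖ξ‖ ^ 2) * K)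
    linarith [hexp _ h2]
  · simp only [entry, hs, ← hξ, symbol12, ← hK, hfreq]
    have : ‖((‖ξ‖ : ℝ) : ℂ) * (-Complex.I * K * (ξ j : ℂ))‖ ≤ B * E := by
      refine le_trans (le_of_eq ?_) ((mul_le_mul_of_nonneg_right
        (mul_le_mul_of_nonneg_left (hcoord j) (norm_nonneg ξ)) (norm_nonneg K)).trans ?_)
      · simp only [norm_mul, norm_neg, Complex.norm_I, one_mul, Complex.norm_real, norm_norm]
        ring
      · rwa [← sq]
    linarith
  · simp only [entry, hs, ← hξ, symbol21, ← hK, hfreq]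
    have : ‖((‖ξ‖⁻¹ : ℝ) : ℂ) * (-Complex.I * (ξ i : ℂ) * (κ : ℂ) * ((‖ξ‖ ^ 2 : ℝ) : ℂ) * K)‖ ≤
        κ * (B * E) := by
      -- This includes $\xi=0$, where the inverse is `0`.
      have h5 : ‖ξ‖⁻¹ * ‖((ξ i : ℝ) : ℂ)‖ ≤ 1 := by
        rw [inv_mul_eq_div]
        exact div_le_one_of_le₀ (hcoord i) (norm_nonneg _)
      calc _ = ‖ξ‖⁻¹ * ‖((ξ i : ℝ) : ℂ)‖ * (κ * (‖ξ‖ ^ 2 * ‖K‖)) := by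
            simp only [norm_mul, norm_neg, Complex.norm_I, one_mul, Complex.norm_real, norm_inv,
              norm_norm, norm_pow, Real.norm_of_nonneg hκ.le]
            ring
        _ ≤ 1 * (κ * (B * E)) := by gcongr
        _ = _ := one_mul _
    linarith
  · simp only [entry, hs, ← hξ, symbol22, kernelTwo_eq, ← hK]
    have h5 : ‖Complex.exp ((-ν * ‖ξ‖ ^ 2 * s : ℝ) : ℂ)‖ ≤ E := by
      rw [Complex.norm_exp, Complex.ofReal_re]
      have := hmono ν (min_le_right _ _)
      rwa [← neg_mul, ← neg_mul] at this
    have h6 : ‖((ξ i * ξ j / ‖ξ‖ ^ 2 : ℝ) : ℂ)‖ ≤ 1 := by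
      rw [Complex.norm_real, Real.norm_eq_abs, abs_div, abs_mul, abs_of_nonneg hx, sq]
      exact div_le_one_of_le₀ (mul_le_mul (abs_coord_le ξ i) (abs_coord_le ξ j) (abs_nonneg _)
        (norm_nonneg _)) (by positivity)
    have h7 : ‖(if i = j then 1 else 0 : ℂ)‖ ≤ 1 := by split_ifs <;> simp
    refine (norm_add_le _ _).trans ?_
    rw [norm_mul, norm_mul]
    have h8 := mul_le_mul h5 h7 (norm_nonneg _) hE0.le
    have h9 := norm_add_le (Complex.exp (lamPlus ν ν' κ (‖ξ‖ ^ 2) * s))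
      (lamMinus ν ν' κ (‖ξ‖ ^ 2) * K)
    have h10 := norm_sub_le (Complex.exp (lamPlus ν ν' κ (‖ξ‖ ^ 2) * s) +
      lamMinus ν ν' κ (‖ξ‖ ^ 2) * K) (Complex.exp ((-ν * ‖ξ‖ ^ 2 * s : ℝ) : ℂ))
    have h11 := mul_le_of_le_one_right (norm_nonneg (Complex.exp (lamPlus ν ν' κ (‖ξ‖ ^ 2) * s) +
      lamMinus ν ν' κ (‖ξ‖ ^ 2) * K - Complex.exp ((-ν * ‖ξ‖ ^ 2 * s : ℝ) : ℂ))) h6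
    linarith [hexp _ h1]

end SymbolDecay

/-! ### The solution operator in rescaled Fourier variables. -/

section Assembly

variable {n : ℕ}

instance instNormedAddCommGroupHighPair (n : ℕ) (r : ℝ) (k j : ℕ) :
    NormedAddCommGroup (HighPair n r k j) :=
  WithLp.instProdNormedAddCommGroup 2 _ _

instance instNormedSpaceHighPair (n : ℕ) (r : ℝ) (k j : ℕ) : NormedSpace ℂ (HighPair n r k j) :=
  WithLp.instProdNormedSpace 2 ℂ _ _

/-- The `L²` function with Fourier transform `χ_{|ξ| ≥ r} |ξ|^{-k} g`. -/
def lowLift (n : ℕ) (r : ℝ) (k : ℕ) : L2 n →L[ℂ] L2 n :=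
  fourierInvCLM ℂ (L2 n) ∘L mulL2 volume (liftSymbol r k (zeroIndex n k).1)

theorem lowLift_apply (r : ℝ) (k : ℕ) (g : L2 n) :
    lowLift n r k g = 𝓕⁻ (mulL2 volume (liftSymbol r k (zeroIndex n k).1) g) := rfl

theorem liftSymbol_zeroIndex (r : ℝ) (k : ℕ) (η : Space n) :
    liftSymbol r k (zeroIndex n k).1 η =
      {η : Space n | r ≤ freq η}.indicator (fun η => (((freq η ^ k)⁻¹ : ℝ) : ℂ)) η := by
  by_cases hη : r ≤ freq η
  · simp [liftSymbol, Set.indicator, hη, monomialSymbol, zeroIndex]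
  · simp [liftSymbol, Set.indicator, hη]

theorem isBddMeas_liftSymbol_zeroIndex {r : ℝ} (hr : 0 < r) (k : ℕ) :
    IsBddMeas (liftSymbol r k (zeroIndex n k).1) :=
  isBddMeas_liftSymbol hr (by simp [zeroIndex])

/-- $|\xi|^{-(k+m)}|\xi|^m=|\xi|^{-k}$ on the high frequencies. In this form $m$ gained powers of
$|\xi|$ become $m$ derivatives of the same function. -/
theorem lowLift_add {r : ℝ} (hr : 0 < r) (k m : ℕ) {g g' : L2 n}
    (h : g' =ᵐ[volume] fun η => ((freq η ^ m : ℝ) : ℂ) * g η) :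
    lowLift n r (k + m) g' = lowLift n r k g := by
  rw [lowLift_apply, lowLift_apply]
  refine congrArg (fun z : L2 n => (𝓕⁻ z : L2 n)) (Lp.ext ?_)
  filter_upwards [coeFn_mulL2 (isBddMeas_liftSymbol_zeroIndex hr (k + m)) g',
    coeFn_mulL2 (isBddMeas_liftSymbol_zeroIndex hr k) g, h] with η h1 h2 h3
  rw [h1, h2, h3, liftSymbol_zeroIndex, liftSymbol_zeroIndex]
  by_cases hη : r ≤ freq η
  · have hf : (freq η : ℂ) ≠ 0 := by exact_mod_cast (hr.trans_le hη).ne'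
    simp only [Set.indicator, Set.mem_ofPred_eq, hη, if_true]
    push_cast
    field_simp
    ring
  · simp [Set.indicator, hη]

/-- Assembling a pair in `H^k_{(∞)} × H^j_{(∞)}` from rescaled Fourier transforms. -/
def toPair (n : ℕ) {r : ℝ} (hr : 0 < r) (k j : ℕ) :
    (Option (Fin n) → L2 n) →L[ℂ] HighPair n r k j :=
  (WithLp.prodContinuousLinearEquiv 2 ℂ (highSobolev n r k)
      (PiLp 2 fun _ : Fin n => highSobolev n r j)).symm.toContinuousLinearMap ∘L
    ((liftHigh n hr k ∘L ContinuousLinearMap.proj none).prod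
      ((PiLp.continuousLinearEquiv 2 ℂ fun _ : Fin n =>
          highSobolev n r j).symm.toContinuousLinearMap ∘L
        ContinuousLinearMap.pi fun i => liftHigh n hr j ∘L ContinuousLinearMap.proj (some i)))

/-- The same as `toPair`, in `L² × (L²)ⁿ`. -/
def toL2Pair (n : ℕ) (r : ℝ) (k j : ℕ) : (Option (Fin n) → L2 n) →L[ℂ] L2Pair n :=
  (WithLp.prodContinuousLinearEquiv 2 ℂ (L2 n)
      (PiLp 2 fun _ : Fin n => L2 n)).symm.toContinuousLinearMap ∘L
    ((lowLift n r k ∘L ContinuousLinearMap.proj none).prod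
      ((PiLp.continuousLinearEquiv 2 ℂ fun _ : Fin n => L2 n).symm.toContinuousLinearMap ∘L
        ContinuousLinearMap.pi fun i => lowLift n r j ∘L ContinuousLinearMap.proj (some i)))

theorem toL2Pair_apply (r : ℝ) (k j : ℕ) (g : Option (Fin n) → L2 n) :
    toL2Pair n r k j g = WithLp.toLp 2 (lowLift n r k (g none),
      WithLp.toLp 2 fun i => lowLift n r j (g (some i))) := rfl

theorem toL2_toPair {r : ℝ} (hr : 0 < r) (k j : ℕ) (g : Option (Fin n) → L2 n) :
    (toPair n hr k j g).toL2 = toL2Pair n r k j g := rfl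

theorem toL2Pair_add {r : ℝ} (hr : 0 < r) (k j m : ℕ) {g g' : Option (Fin n) → L2 n}
    (h : ∀ l, g' l =ᵐ[volume] fun η => ((freq η ^ m : ℝ) : ℂ) * g l η) :
    toL2Pair n r (k + m) (j + m) g' = toL2Pair n r k j g := by
  simp only [toL2Pair_apply, lowLift_add hr _ m (h _)]

/-- The rescaled Fourier transforms `(|ξ|^k φ̂, |ξ|^j m̂)` of a pair. -/
def ofPair (n : ℕ) (r : ℝ) (k j : ℕ) : HighPair n r k j →L[ℂ] (Option (Fin n) → L2 n) :=
  ContinuousLinearMap.pi fun l => l.elim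
    (lowerHigh n r k ∘L WithLp.fstL 2 ℂ (highSobolev n r k)
      (PiLp 2 fun _ : Fin n => highSobolev n r j))
    fun i => lowerHigh n r j ∘L PiLp.proj 2 (fun _ : Fin n => highSobolev n r j) i ∘L
      WithLp.sndL 2 ℂ (highSobolev n r k) (PiLp 2 fun _ : Fin n => highSobolev n r j)

theorem ofPair_none {r : ℝ} {k j : ℕ} (u : HighPair n r k j) :
    ofPair n r k j u none = lowerHigh n r k u.fst := rfl

theorem ofPair_some {r : ℝ} {k j : ℕ} (u : HighPair n r k j) (i : Fin n) :
    ofPair n r k j u (some i) = lowerHigh n r j (u.snd i) := rfl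

theorem ofFourier_eq_lowLift {r : ℝ} (hr : 0 < r) {k : ℕ} {g : Space n → ℂ}
    (hg : MemLp g 2 volume) {h : L2 n}
    (hgh : g =ᵐ[volume] fun η => liftSymbol r k (zeroIndex n k).1 η * h η) :
    ofFourier g = lowLift n r k h := by
  rw [ofFourier, dif_pos hg, lowLift_apply]
  refine congrArg (fun z : L2 n => (𝓕⁻ z : L2 n)) (Lp.ext ?_)
  filter_upwards [hg.coeFn_toLp, hgh, coeFn_mulL2 (isBddMeas_liftSymbol_zeroIndex hr k) h]
    with η h1 h2 h3
  rw [h1, h2, h3]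

/-- The solution operator in rescaled Fourier variables. -/
theorem solOp_toL2 {ν ν' κ : ℝ} (hν : 0 < ν) (hνν' : 0 < ν + ν') (hκ : 0 < κ) (hn : 0 < n) {r : ℝ}
    (hr : 0 < r) {t : ℝ} (ht : 0 ≤ t) (k : ℕ) (u : HighPair n r (k + 1) k) :
    solOp ν ν' κ t u.toL2 = toL2Pair n r (k + 1) k fun l =>
      ∑ l', mulL2 volume (entry ν ν' κ l l' t) (ofPair n r (k + 1) k u l') := by
  obtain ⟨C, c, hCc⟩ := exists_isDecaying_entry (n := n) hν hνν' hκ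
  have hφ := coeFn_lowerHigh hn u.fst
  have hm : ∀ᵐ η : Space n, ∀ i, (lowerHigh n r k (u.snd i) : Space n → ℂ) η =
      (freq η ^ k : ℝ) * (𝓕 ((u.snd i).1 (zeroIndex n k)) : L2 n) η :=
    ae_all_iff.2 fun i => coeFn_lowerHigh hn (u.snd i)
  have hφ0 := fourier_eq_zero_of_lt u.fst
  have hm0 : ∀ᵐ η : Space n, ∀ i, freq η < r →
      (𝓕 ((u.snd i).1 (zeroIndex n k)) : L2 n) η = 0 :=
    ae_all_iff.2 fun i => fourier_eq_zero_of_lt (u.snd i)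
  have hent : ∀ l, ∀ᵐ η : Space n, ∀ l', (mulL2 volume (entry ν ν' κ l l' t)
      (ofPair n r (k + 1) k u l') : Space n → ℂ) η =
        entry ν ν' κ l l' t η * ofPair n r (k + 1) k u l' η := fun l =>
    ae_all_iff.2 fun l' => coeFn_mulL2 ((hCc l l').isBddMeas t) _
  rw [toL2Pair_apply, solOp]
  congr 2
  · refine ofFourier_eq_lowLift hr (memLp_densityHat hνν' hκ ht _) ?_
    filter_upwards [hφ, hm, hφ0, hm0, hent none, coeFn_finsetSum Finset.univ fun l' =>
      mulL2 volume (entry ν ν' κ none l' t) (ofPair n r (k + 1) k u l')]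
      with η h1 h2 h3 h4 h5 h6
    rw [h6, liftSymbol_zeroIndex, Fintype.sum_option]
    simp only [h5]
    simp only [ofPair_none, ofPair_some, h1, h2]
    simp only [densityHat, entry, max_eq_left ht]
    change _ * (𝓕 (u.fst.1 (zeroIndex n (k + 1))) : L2 n) η +
      ∑ j, _ * (𝓕 ((u.snd j).1 (zeroIndex n k)) : L2 n) η = _
    -- Below $r$ the data vanish on the Fourier side and the lift is cut off. Above $r$ the powers
    -- of $|\xi|$ cancel: $|\xi|^{-(k+1)}\bigl(S_{11}|\xi|^{k+1}\hat\phi+|\xi|S_{12}|\xi|^k\hat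
    -- m\bigr)$.
    rcases lt_or_ge (freq η) r with h | h
    · simp [h3 h, h4 _ h]
    · have hf : (freq η : ℂ) ≠ 0 := by exact_mod_cast (hr.trans_le h).ne'
      simp only [Set.indicator, Set.mem_ofPred_eq, h, if_true]
      rw [mul_add, Finset.mul_sum]
      push_cast
      congr 1
      · field_simp
      · refine Finset.sum_congr rfl fun j _ => ?_
        field_simp
        ring
  · congr 1
    funext i
    refine ofFourier_eq_lowLift hr (memLp_momentumHat hν.le hνν' hκ ht _ i) ?_
    filter_upwards [hφ, hm, hφ0, hm0, hent (some i), coeFn_finsetSum Finset.univ fun l' =>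
      mulL2 volume (entry ν ν' κ (some i) l' t) (ofPair n r (k + 1) k u l')]
      with η h1 h2 h3 h4 h5 h6
    rw [h6, liftSymbol_zeroIndex, Fintype.sum_option]
    simp only [h5]
    simp only [ofPair_none, ofPair_some, h1, h2]
    simp only [momentumHat, entry, max_eq_left ht]
    change _ * (𝓕 (u.fst.1 (zeroIndex n (k + 1))) : L2 n) η +
      ∑ j, _ * (𝓕 ((u.snd j).1 (zeroIndex n k)) : L2 n) η = _
    -- As for the density, now with
    -- $|\xi|^{-k}\bigl(|\xi|^{-1}S_{21}|\xi|^{k+1}\hat\phi+S_{22}|\xi|^k\hat m\bigr)$.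
    rcases lt_or_ge (freq η) r with h | h
    · simp [h3 h, h4 _ h]
    · have hf : (freq η : ℂ) ≠ 0 := by exact_mod_cast (hr.trans_le h).ne'
      simp only [Set.indicator, Set.mem_ofPred_eq, h, if_true]
      rw [mul_add, Finset.mul_sum]
      push_cast
      congr 1
      · field_simp
        ring
      · refine Finset.sum_congr rfl fun j _ => ?_
        field_simp

end Assembly

/-! ### The Duhamel integral, entry by entry. -/

section Duhamel

open Set

variable {n : ℕ}

/-- The restriction of a linear map on `(L²)^{1+n}` to one of its components. -/
def component {H : Type*} [AddCommGroup H] [Module ℂ H] [TopologicalSpace H]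
    (A : (Option (Fin n) → L2 n) →L[ℂ] H) (l : Option (Fin n)) : L2 n →L[ℂ] H :=
  A ∘L ContinuousLinearMap.single ℂ (fun _ : Option (Fin n) => L2 n) l

/-- Separates the matrix entries, so that the scalar estimates apply to each of them. -/
theorem sum_component {H : Type*} [AddCommGroup H] [Module ℂ H] [TopologicalSpace H]
    (A : (Option (Fin n) → L2 n) →L[ℂ] H) (g : Option (Fin n) → Option (Fin n) → L2 n) :
    A (fun l => ∑ l', g l l') = ∑ l, ∑ l', component A l (g l l') := by
  conv_lhs => rw [← Finset.univ_sum_single (fun l => ∑ l', g l l'), map_sum]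
  refine Finset.sum_congr rfl fun l _ => ?_
  rw [← map_sum]
  rfl

theorem eLpNorm_comp_le {E H : Type*} [NormedAddCommGroup E] [NormedSpace ℂ E]
    [NormedAddCommGroup H] [NormedSpace ℂ H] (A : E →L[ℂ] H) (f : ℝ → E) (ν : Measure ℝ) :
    eLpNorm (fun t => A (f t)) 2 ν ≤ ‖A‖ₑ * eLpNorm f 2 ν :=
  eLpNorm_le_nnreal_smul_eLpNorm_of_ae_le_mul (c := ‖A‖₊)
    (Filter.Eventually.of_forall fun t => A.le_opNorm (f t)) 2

theorem enorm_sum_component_le {H : Type*} [NormedAddCommGroup H] [NormedSpace ℂ H]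
    (A : (Option (Fin n) → L2 n) →L[ℂ] H) {g : Option (Fin n) → Option (Fin n) → L2 n}
    {b : Option (Fin n) → Option (Fin n) → ℝ≥0∞} (hg : ∀ l l', ‖g l l'‖ₑ ≤ b l l') :
    ‖∑ l, ∑ l', component A l (g l l')‖ₑ ≤ ∑ l, ∑ l', ‖component A l‖ₑ * b l l' := by
  refine (enorm_sum_le _ _).trans (Finset.sum_le_sum fun l _ => (enorm_sum_le _ _).trans
    (Finset.sum_le_sum fun l' _ => ?_))
  refine ((component A l).le_opENorm _).trans ?_
  gcongr
  exact hg l l'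

theorem eLpNorm_sum_component_le {H : Type*} [NormedAddCommGroup H] [NormedSpace ℂ H]
    (A : (Option (Fin n) → L2 n) →L[ℂ] H) {g : Option (Fin n) → Option (Fin n) → ℝ → L2 n}
    {ν : Measure ℝ} (hm : ∀ l l', MemLp (g l l') 2 ν)
    {b : Option (Fin n) → Option (Fin n) → ℝ≥0∞} (hg : ∀ l l', eLpNorm (g l l') 2 ν ≤ b l l') :
    eLpNorm (fun t => ∑ l, ∑ l', component A l (g l l' t)) 2 ν ≤
      ∑ l, ∑ l', ‖component A l‖ₑ * b l l' := by
  have h1 : ∀ l l', AEStronglyMeasurable (fun t => component A l (g l l' t)) ν := fun l l' =>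
    (component A l).continuous.comp_aestronglyMeasurable (hm l l').1
  have h2 : (fun t => ∑ l, ∑ l', component A l (g l l' t)) =
      ∑ l, ∑ l', fun t => component A l (g l l' t) := by
    ext1 t
    simp only [Finset.sum_apply]
  rw [h2]
  refine (eLpNorm_sum_le (fun l _ => Finset.aestronglyMeasurable_sum _ fun l' _ => h1 l l')
    one_le_two).trans (Finset.sum_le_sum fun l _ => (eLpNorm_sum_le (fun l' _ => h1 l l')
      one_le_two).trans (Finset.sum_le_sum fun l' _ => ?_))
  refine (eLpNorm_comp_le _ _ _).trans ?_
  gcongr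
  exact hg l l'

section

variable {ν ν' κ : ℝ} (hν : 0 < ν) (hνν' : 0 < ν + ν') (hκ : 0 < κ) (hn : 0 < n) {r : ℝ}
  (hr : 0 < r) {k : ℕ} {F : ℝ → HighPair n r (k + 1) k} {T t : ℝ}
include hν hνν' hκ hn hr

theorem intervalIntegrable_solOp (hF : IntegrableOn F (Ioo 0 T)) (ht : t ∈ Icc 0 T) :
    IntervalIntegrable (fun τ => solOp ν ν' κ (t - τ) (F τ).toL2) volume 0 t := by
  obtain ⟨C, c, hCc⟩ := exists_isDecaying_entry (n := n) hν hνν' hκ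
  rw [intervalIntegrable_iff_integrableOn_Ioo_of_le ht.1]
  have h1 : IntegrableOn (fun τ => ∑ l, ∑ l', component (toL2Pair n r (k + 1) k) l
      (mulL2 volume (entry ν ν' κ l l' (t - τ)) (ofPair n r (k + 1) k (F τ) l'))) (Ioo 0 t) := by
    refine integrable_finsetSum _ fun l _ => integrable_finsetSum _ fun l' _ => ?_
    refine ContinuousLinearMap.integrable_comp (component (toL2Pair n r (k + 1) k) l)
      ((hCc l l').integrable ?_ t)
    exact ContinuousLinearMap.integrable_comp
      (ContinuousLinearMap.proj (R := ℂ) (φ := fun _ : Option (Fin n) => L2 n) l' ∘L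
        ofPair n r (k + 1) k) (hF.mono_set (Ioo_subset_Ioo_right ht.2))
  refine h1.congr_fun (fun τ hτ => ?_) measurableSet_Ioo
  simp only
  rw [solOp_toL2 hν hνν' hκ hn hr (sub_nonneg.2 hτ.2.le), sum_component]

/-- Bounded linear maps commute with the Bochner integral, so the Duhamel term is assembled from
scalar time convolutions. On $0<\tau<t$ the truncation of time at `0` in `entry` has no effect. -/
theorem duhamel_eq (hF : IntegrableOn F (Ioo 0 T)) (ht : t ∈ Icc 0 T) :
    duhamel ν ν' κ F t = toL2Pair n r (k + 1) k fun l => ∑ l',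
      timeConv volume (entry ν ν' κ l l') (fun τ => ofPair n r (k + 1) k (F τ) l') t := by
  obtain ⟨C, c, hCc⟩ := exists_isDecaying_entry (n := n) hν hνν' hκ
  have h1 : ∀ l l', IntegrableOn (fun τ => mulL2 volume (entry ν ν' κ l l' (t - τ))
      (ofPair n r (k + 1) k (F τ) l')) (Ioo 0 t) := fun l l' =>
    (hCc l l').integrable (ContinuousLinearMap.integrable_comp
      (ContinuousLinearMap.proj (R := ℂ) (φ := fun _ : Option (Fin n) => L2 n) l' ∘L
        ofPair n r (k + 1) k) (hF.mono_set (Ioo_subset_Ioo_right ht.2))) t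
  have h2 : ∀ l l', IntegrableOn (fun τ => component (toL2Pair n r (k + 1) k) l
      (mulL2 volume (entry ν ν' κ l l' (t - τ)) (ofPair n r (k + 1) k (F τ) l'))) (Ioo 0 t) :=
    fun l l' => ContinuousLinearMap.integrable_comp _ (h1 l l')
  rw [duhamel, intervalIntegral.integral_of_le ht.1, integral_Ioc_eq_integral_Ioo,
    setIntegral_congr_fun (g := fun τ => ∑ l, ∑ l', component (toL2Pair n r (k + 1) k) l
      (mulL2 volume (entry ν ν' κ l l' (t - τ)) (ofPair n r (k + 1) k (F τ) l')))
      measurableSet_Ioo fun τ hτ => by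
        rw [solOp_toL2 hν hνν' hκ hn hr (sub_nonneg.2 hτ.2.le), sum_component],
    integral_finsetSum _ fun l _ => integrable_finsetSum _ fun l' _ => h2 l l', sum_component]
  refine Finset.sum_congr rfl fun l _ => ?_
  rw [integral_finsetSum _ fun l' _ => h2 l l']
  refine Finset.sum_congr rfl fun l' _ => ?_
  rw [ContinuousLinearMap.integral_comp_comm _ (h1 l l'), IsDecaying.timeConv_eq ht.1]

end

set_option maxHeartbeats 1000000 in
/-- The Duhamel term gains one derivative uniformly in time and two in the mean square. -/
theorem exists_duhamel_bounds {ν ν' κ : ℝ} (hν : 0 < ν) (hνν' : 0 < ν + ν') (hκ : 0 < κ)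
    (hn : 0 < n) {r : ℝ} (hr : 0 < r) (k : ℕ) :
    ∃ C : ℝ≥0, ∀ (T : ℝ) (F : ℝ → HighPair n r (k + 1) k),
      MemLp F 2 (volume.restrict (Ioo 0 T)) →
        (∀ t ∈ Icc 0 T, IntervalIntegrable
          (fun τ => solOp ν ν' κ (t - τ) (F τ).toL2) volume 0 t) ∧
        ∃ (U : ℝ → HighPair n r (k + 1 + 1) (k + 1)) (V : ℝ → HighPair n r (k + 1 + 2) (k + 2)),
          ContinuousOn U (Icc 0 T) ∧
          (∀ t ∈ Icc 0 T, (U t).toL2 = duhamel ν ν' κ F t) ∧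
          MemLp V 2 (volume.restrict (Ioo 0 T)) ∧
          (∀ᵐ t ∂volume.restrict (Ioo 0 T), (V t).toL2 = duhamel ν ν' κ F t) ∧
          ∀ t ∈ Icc 0 T, ‖U t‖ₑ + eLpNorm V 2 (volume.restrict (Ioo 0 T)) ≤
            C * eLpNorm F 2 (volume.restrict (Ioo 0 T)) := by
  obtain ⟨C, c, hCc⟩ := exists_isDecaying_entry (n := n) hν hνν' hκ
  let D : Option (Fin n) → HighPair n r (k + 1) k →L[ℂ] L2 n := fun l =>
    ContinuousLinearMap.proj (R := ℂ) (φ := fun _ : Option (Fin n) => L2 n) l ∘L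
      ofPair n r (k + 1) k
  set A := toPair n hr (k + 1 + 1) (k + 1) with hA
  set B := toPair n hr (k + 1 + 2) (k + 2) with hB
  -- The scalar constants $C/\sqrt c$ (one derivative) and $C/c$ (two derivatives), weighted by the
  -- norms of the maps to and from the rescaled variables. Neither $T$ nor $F$ enters.
  let K : ℝ≥0∞ := (∑ l, ∑ l', ‖component A l‖ₑ * (ENNReal.ofReal (C / √c) * ‖D l'‖ₑ)) +
    ∑ l, ∑ l', ‖component B l‖ₑ * (ENNReal.ofReal (C / c) * ‖D l'‖ₑ)
  have hK : K ≠ ∞ := by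
    refine ENNReal.add_ne_top.2 ⟨?_, ?_⟩ <;>
    exact (ENNReal.sum_lt_top.2 fun l _ => ENNReal.sum_lt_top.2 fun l' _ => by finiteness).ne
  refine ⟨K.toNNReal, fun T F hF => ?_⟩
  set ρ := volume.restrict (Ioo 0 T) with hρ
  have hFi : IntegrableOn F (Ioo 0 T) := hF.integrable one_le_two
  have hf : ∀ l, MemLp (fun τ => D l (F τ)) 2 ρ := fun l => (D l).comp_memLp' hF
  have hfle : ∀ l, eLpNorm (fun τ => D l (F τ)) 2 ρ ≤ ‖D l‖ₑ * eLpNorm F 2 ρ := fun l =>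
    eLpNorm_comp_le (D l) F ρ
  have hwm := (continuous_freq (n := n)).measurable
  choose U hUc hUeq hUle using fun l l' =>
    (hCc l l').exists_continuousOn hwm freq_nonneg (hf l')
  choose V hVm hVeq hVle using fun l l' =>
    (hCc l l').exists_memLp hwm freq_nonneg (hf l')
  refine ⟨fun t ht => intervalIntegrable_solOp hν hνν' hκ hn hr hFi ht,
    fun t => ∑ l, ∑ l', component A l (U l l' t), fun t => ∑ l, ∑ l', component B l (V l l' t),
    ?_, fun t ht => ?_, ?_, ?_, fun t ht => ?_⟩
  · exact continuousOn_finsetSum _ fun l _ => continuousOn_finsetSum _ fun l' _ =>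
      (component A l).continuous.comp_continuousOn (hUc l l')
  · rw [duhamel_eq hν hνν' hκ hn hr hFi ht]
    simp only
    rw [← sum_component, hA, toL2_toPair]
    -- Each `U l l' t` is $|\xi|$ times a convolution, so lifting it with one more negative power of
    -- $|\xi|$ gives the same pair.
    refine toL2Pair_add hr (k + 1) k 1 fun l => ?_
    filter_upwards [coeFn_finsetSum Finset.univ fun l' => U l l' t, coeFn_finsetSum Finset.univ
      fun l' => timeConv volume (entry ν ν' κ l l') (fun τ => D l' (F τ)) t,
      ae_all_iff.2 fun l' => hUeq l l' t ht] with η h1 h2 h3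
    refine h1.trans (Eq.trans ?_ (congrArg _ h2.symm))
    simp only [h3, Finset.mul_sum, pow_one]
  · exact memLp_finsetSum _ fun l _ => memLp_finsetSum _ fun l' _ =>
      (component B l).comp_memLp' (hVm l l')
  · have h0 : ∀ᵐ t ∂ρ, t ∈ Ioo 0 T := ae_restrict_mem measurableSet_Ioo
    filter_upwards [h0, ae_all_iff.2 fun l => ae_all_iff.2 fun l' => hVeq l l'] with t ht h
    rw [duhamel_eq hν hνν' hκ hn hr hFi (Ioo_subset_Icc_self ht), ← sum_component, hB, toL2_toPair]
    -- The same with $|\xi|^2$, for almost every time only.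
    refine toL2Pair_add hr (k + 1) k 2 fun l => ?_
    filter_upwards [coeFn_finsetSum Finset.univ fun l' => V l l' t, coeFn_finsetSum Finset.univ
      fun l' => timeConv volume (entry ν ν' κ l l') (fun τ => D l' (F τ)) t,
      ae_all_iff.2 fun l' => h l l'] with η h1 h2 h3
    refine h1.trans (Eq.trans ?_ (congrArg _ h2.symm))
    simp only [h3, Finset.mul_sum, sq]
  · rw [ENNReal.coe_toNNReal hK, add_mul]
    refine add_le_add ?_ ?_
    · refine (enorm_sum_component_le A (b := fun _ l' => ENNReal.ofReal (C / √c) *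
        (‖D l'‖ₑ * eLpNorm F 2 ρ)) fun l l' => (hUle l l' t ht).trans ?_).trans (le_of_eq ?_)
      · gcongr
        exact hfle l'
      · simp only [Finset.sum_mul, mul_assoc]
    · refine (eLpNorm_sum_component_le B hVm (b := fun _ l' => ENNReal.ofReal (C / c) *
        (‖D l'‖ₑ * eLpNorm F 2 ρ)) fun l l' => (hVle l l').trans ?_).trans (le_of_eq ?_)
      · gcongr
        exact hfle l'
      · simp only [Finset.sum_mul, mul_assoc]

end Duhamel

end NSK

end
-- The estimate for the original parameters.
open NSK in
theorem proposition4p4 (n : ℕ) (hn : 3 ≤ n) (s : ℕ) (hs : 1 ≤ s)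
    (μ μ' κ : ℝ) (hμ : 0 < μ) (hμ' : 0 ≤ 2 / (n : ℝ) * μ + μ') (hκ : 0 < κ)
    (r₁ : ℝ) (hr₁ : 0 < r₁) :
    ∃ C : ℝ≥0, ∀ (T : ℝ), 0 < T →
      ∀ F : ℝ → HighPair n r₁ s (s - 1), MemLp F 2 (volume.restrict (Set.Ioo 0 T)) →
        (∀ t ∈ Set.Icc 0 T, IntervalIntegrable
          (fun τ => solOp μ (μ + μ') κ (t - τ) (F τ).toL2) volume 0 t) ∧
        ∃ (U : ℝ → HighPair n r₁ (s + 1) s) (V : ℝ → HighPair n r₁ (s + 2) (s + 1)),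
          ContinuousOn U (Set.Icc 0 T) ∧
          (∀ t ∈ Set.Icc 0 T, (U t).toL2 = duhamel μ (μ + μ') κ F t) ∧
          MemLp V 2 (volume.restrict (Set.Ioo 0 T)) ∧
          (∀ᵐ t ∂volume.restrict (Set.Ioo 0 T), (V t).toL2 = duhamel μ (μ + μ') κ F t) ∧
          ∀ t ∈ Set.Icc 0 T,
            ‖U t‖ₑ + eLpNorm V 2 (volume.restrict (Set.Ioo 0 T)) ≤
              C * eLpNorm F 2 (volume.restrict (Set.Ioo 0 T)) := by
  obtain ⟨k, rfl⟩ : ∃ k, s = k + 1 := ⟨s - 1, (Nat.sub_add_cancel hs).symm⟩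
  have hn' : (3 : ℝ) ≤ n := by exact_mod_cast hn
  -- With the assumption on $\mu'$ this yields $\mu+\mu'\ge0$, hence $\nu+\tilde\nu=2\mu+\mu'>0$.
  have h1 : 2 / (n : ℝ) * μ ≤ 1 * μ := by
    gcongr
    rw [div_le_one (by linarith)]
    linarith
  obtain ⟨C, hC⟩ := exists_duhamel_bounds (n := n) (ν := μ) (ν' := μ + μ') hμ (by linarith) hκ
    (by omega) hr₁ k
  exact ⟨C, fun T _ F hF => hC T F hF⟩
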